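/- Let $n\in\mathbb N_0$, let $\Omega\subseteq\mathbb R^n$ be open and let $1\le r<s$ be real numbers. Write $D_j=-i\,\partial_{x_j}$ and $D^\alpha=D_1^{\alpha_1}\cdots D_n^{\alpha_n}$. For real $\sigma\ge 1$ let $\mathcal G^\sigma(\Omega)$ be the space of all complex-valued $f\in C^\infty(\Omega)$ such that for every compact $K\subseteq\Omega$ there are $C,h>0$ with $$|D^\alpha f(x)|\le C\,h^{|\alpha|}\,(|\alpha|!)^{\sigma}\qquad\text{for all }x\in K,\ \alpha\in\mathbb N_0^n .$$ Let $d\in\mathbb N_0$ and let $P=\sum_{|\alpha|\le d}p_\alpha(x)D^\alpha$ be a linear differential operator with coefficients $p_\alpha\in\mathcal G^r(\Omega)$, considered as an operator of order $d$ (it is not required that some $p_\alpha$ with $|\alpha|=d$ is not identically zero). Suppose that $P$ is not elliptic in $\Omega$, i.e. there are $x_0\in\Omega$ and $\xi_0\in\mathbb R^n\setminus\{0\}$ with $\sum_{|\alpha|=d}p_\alpha(x_0)\xi_0^\alpha=0$. Then there is a smooth function $u\in C^\infty(\Omega)$ which is a Gevrey-$s$ vector of $P$, i.e. $P^ku\in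 L^2_{loc}(\Omega)$ for all $k\in\mathbb N_0$ and for every compact $K\subseteq\Omega$ there are $C,h>0$ with $$\|P^ku\|_{L^2(K)}\le C\,h^k\,\big((dk)!\big)^{s}\qquad\text{for all }k\in\mathbb N_0,$$ but which does not belong to $\mathcal G^s(\Omega)$. -/

import Mathlib

open scoped ContDiff

/-- The derivative `D_j = -i ∂_j` of a complex valued function on `ℝⁿ`. -/
noncomputable def partialD {n : ℕ} (j : Fin n) (f : EuclideanSpace ℝ (Fin n) → ℂ) :
    EuclideanSpace ℝ (Fin n) → ℂ :=
  fun x => -Complex.I * fderiv ℝ f x (EuclideanSpace.single j (1 : ℝ))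

/-- `D^α f = D_1^{α_1} ⋯ D_n^{α_n} f` for a multi-index `α`. At a point of an open set on which `f`
is smooth this depends only on `f` near that point. -/
noncomputable def multiD {n : ℕ} (α : Fin n → ℕ) (f : EuclideanSpace ℝ (Fin n) → ℂ) :
    EuclideanSpace ℝ (Fin n) → ℂ :=
  (List.finRange n).foldr (fun j g => (partialD j)^[α j] g) f

/-- `f` is a Gevrey function of order `s` in `Ω` (the class `𝒢^s(Ω)`): `f` is smooth in `Ω`, and
for every compact `K ⊆ Ω` there are `C, h > 0` such that
`|D^α f(x)| ≤ C h^{|α|} (|α|!)^s` for all `x ∈ K` and all multi-indices `α`. -/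
def IsGevrey {n : ℕ} (s : ℝ) (Ω : Set (EuclideanSpace ℝ (Fin n)))
    (f : EuclideanSpace ℝ (Fin n) → ℂ) : Prop :=
  ContDiffOn ℝ ∞ f Ω ∧
    ∀ K : Set (EuclideanSpace ℝ (Fin n)), IsCompact K → K ⊆ Ω →
      ∃ C : ℝ, 0 < C ∧ ∃ h : ℝ, 0 < h ∧ ∀ α : Fin n → ℕ, ∀ x ∈ K,
        ‖multiD α f x‖ ≤ C * h ^ (∑ i, α i) * (((∑ i, α i).factorial : ℕ) : ℝ) ^ s

/-- A linear differential operator `P = ∑_{|α| ≤ d} p_α D^α`, given by the number `d` and its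
coefficients. The values `coeff α` with `|α| > order` play no role. -/
structure LinDiffOp (n : ℕ) where
  /-- the order `d` -/
  order : ℕ
  /-- the coefficient functions `p_α` -/
  coeff : (Fin n → ℕ) → EuclideanSpace ℝ (Fin n) → ℂ

namespace LinDiffOp

/-- `P u = ∑_{|α| ≤ d} p_α D^α u`. -/
noncomputable def apply {n : ℕ} (P : LinDiffOp n) (u : EuclideanSpace ℝ (Fin n) → ℂ) :
    EuclideanSpace ℝ (Fin n) → ℂ :=
  fun x => ∑ j ∈ Finset.range (P.order + 1),
    ∑ α ∈ Finset.piAntidiag (Finset.univ : Finset (Fin n)) j, P.coeff α x * multiD α u x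

/-- The principal symbol `p_d(x, ξ) = ∑_{|α| = d} p_α(x) ξ^α`. -/
noncomputable def principalSymbol {n : ℕ} (P : LinDiffOp n) (x ξ : EuclideanSpace ℝ (Fin n)) : ℂ :=
  ∑ α ∈ Finset.piAntidiag (Finset.univ : Finset (Fin n)) P.order,
    P.coeff α x * ∏ i, ((ξ i : ℝ) : ℂ) ^ α i

/-- `P` is elliptic in `Ω`: the principal symbol has no zero `(x, ξ)` with `x ∈ Ω`, `ξ ≠ 0`. -/
def IsElliptic {n : ℕ} (P : LinDiffOp n) (Ω : Set (EuclideanSpace ℝ (Fin n))) : Prop :=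
  ∀ x ∈ Ω, ∀ ξ : EuclideanSpace ℝ (Fin n), ξ ≠ 0 → P.principalSymbol x ξ ≠ 0

/-- All coefficients `p_α`, `|α| ≤ d`, of `P` are Gevrey functions of order `r` in `Ω`. -/
def HasGevreyCoeffs {n : ℕ} (P : LinDiffOp n) (r : ℝ) (Ω : Set (EuclideanSpace ℝ (Fin n))) :
    Prop :=
  ∀ α : Fin n → ℕ, ∑ i, α i ≤ P.order → IsGevrey r Ω (P.coeff α)

/-- For an operator `P` with smooth coefficients and a smooth function `u` in the open set `Ω`
(so that the iterates `P^k u` in the sense of distributions are the classical ones): `u` is a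
Gevrey vector of order `s` of `P` in `Ω` (`u ∈ 𝒢^s(Ω; P)`), i.e. all `P^k u` are in `L²_loc(Ω)` and
for every compact `K ⊆ Ω` there are `C, h > 0` such that
`‖P^k u‖_{L²(K)} ≤ C h^k ((dk)!)^s` for all `k ≥ 0`. -/
def IsGevreyVector {n : ℕ} (P : LinDiffOp n) (s : ℝ) (Ω : Set (EuclideanSpace ℝ (Fin n)))
    (u : EuclideanSpace ℝ (Fin n) → ℂ) : Prop :=
  ∀ K : Set (EuclideanSpace ℝ (Fin n)), IsCompact K → K ⊆ Ω →
    (∀ k : ℕ, MeasureTheory.MemLp (P.apply^[k] u) 2 (MeasureTheory.volume.restrict K)) ∧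
    ∃ C : ℝ, 0 < C ∧ ∃ h : ℝ, 0 < h ∧ ∀ k : ℕ,
      MeasureTheory.eLpNorm (P.apply^[k] u) 2 (MeasureTheory.volume.restrict K) ≤
        ENNReal.ofReal (C * h ^ k * (((P.order * k).factorial : ℕ) : ℝ) ^ s)

end LinDiffOp

/-! The witness is a superposition `u = ∑ exp(-j) w_j` of Gaussian wave packets `w_j(x) = exp(i lam
(x - x₀)·ξ - lam |x - x₀|²/2)` of frequency `lam = j^σ`, placed at a zero `(x₀, ξ)` of the principal
symbol, with `σ` slightly larger than `s`.

Failure of Gevrey regularity: after scaling to `ξ i = 1`, the numbers `D_i^m w_j(x₀)` are real and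
at least `lam^m`. Nothing cancels, and the term `j = m` alone makes `D_i^m u(x₀)` at least `exp(-m)
m^(σ m)`, too large for order `s < σ` (`not_isGevrey_packet_series`).

Iterates of `P`: on `w g` the operator acts as `w` times a conjugated operator on `g`, where each
`D_j` becomes `D_j + lam (ξ_j + i (x - x₀)_j)`. The coefficient of `lam^d` without derivatives of
`g` or of the covector is the principal symbol at `ξ + i (x - x₀)`, which is `O(|x - x₀|)`. Every
other contribution has a lower power of `lam` or contains a derivative that does not fall on the
exponential. Let `Y = max(1, dk)^r` be the cost of a derivative on a coefficient, and `Λ = max(lam,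
Y)`. Then each of the `k` applications costs `C Λ^d t` with `t = max(min(1, |x - x₀|), √(Y/Λ))`
(`bound_conj`, `norm_iterate_conj_le`).

The Gaussian modulus trades `|x - x₀|^k` for `(Y/lam)^(k/2)`. So for `lam > Y` and `dk > 0` the
iterate is bounded by `C^k lam^((d - 1/2) k) (dk)^(r k/2)`: half a power of `lam` is saved per
application. Part of `exp(-j)` turns the power of `j` into the same power of `dk`, and the result is
at most `C^k (dk)!^s` as soon as `σ (d - 1/2) + r/2 ≤ s d` (`packet_term_le`). Since `r < s`, this
leaves room for some `σ > s`. Summing over `j` gives `isGevreyVector_packet_series`. -/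

/-- The real Euclidean space `ℝⁿ`. -/
abbrev Euc (n : ℕ) := EuclideanSpace ℝ (Fin n)

/-! ### First order derivatives -/

section Derivatives

variable {n : ℕ} {Ω : Set (Euc n)} {f g : Euc n → ℂ} {x : Euc n}

theorem ContDiffOn.differentiableAt_of_isOpen (hΩ : IsOpen Ω) (hf : ContDiffOn ℝ ∞ f Ω)
    (hx : x ∈ Ω) : DifferentiableAt ℝ f x :=
  (hf.contDiffAt (hΩ.mem_nhds hx)).differentiableAt (by simp)

theorem partialD_contDiffOn (hΩ : IsOpen Ω) (hf : ContDiffOn ℝ ∞ f Ω) (j : Fin n) :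
    ContDiffOn ℝ ∞ (partialD j f) Ω := by
  have h : ContDiffOn ℝ ∞ (fderiv ℝ f) Ω := hf.fderiv_of_isOpen hΩ (by simp)
  unfold partialD
  exact contDiffOn_const.mul (h.clm_apply contDiffOn_const)

theorem partialD_congr (hΩ : IsOpen Ω) (h : Set.EqOn f g Ω) (j : Fin n) :
    Set.EqOn (partialD j f) (partialD j g) Ω := by
  intro x hx
  have : f =ᶠ[nhds x] g := Filter.eventuallyEq_of_mem (hΩ.mem_nhds hx) h
  simp only [partialD, this.fderiv_eq]

theorem partialD_add_apply (hf : DifferentiableAt ℝ f x) (hg : DifferentiableAt ℝ g x)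
    (j : Fin n) :
    partialD j (fun y => f y + g y) x = partialD j f x + partialD j g x := by
  simp only [partialD]
  rw [fderiv_fun_add hf hg, add_apply]
  ring

theorem partialD_mul_apply (hf : DifferentiableAt ℝ f x) (hg : DifferentiableAt ℝ g x)
    (j : Fin n) :
    partialD j (fun y => f y * g y) x = partialD j f x * g x + f x * partialD j g x := by
  simp only [partialD]
  rw [fderiv_fun_mul hf hg]
  simp only [add_apply, smul_apply, smul_eq_mul]
  ring

theorem partialD_const (c : ℂ) (j : Fin n) : partialD j (fun _ : Euc n => c) = fun _ => 0 := by
  funext x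
  simp [partialD]

theorem partialD_const_mul_apply (hf : DifferentiableAt ℝ f x) (c : ℂ) (j : Fin n) :
    partialD j (fun y => c * f y) x = c * partialD j f x := by
  rw [partialD_mul_apply (differentiableAt_const c) hf, partialD_const]
  simp

theorem partialD_comm (hΩ : IsOpen Ω) (hf : ContDiffOn ℝ ∞ f Ω) (i j : Fin n) :
    Set.EqOn (partialD i (partialD j f)) (partialD j (partialD i f)) Ω := by
  intro x hx
  have hd : DifferentiableAt ℝ (fderiv ℝ f) x :=
    ((hf.fderiv_of_isOpen (m := ∞) hΩ (by simp)).contDiffAt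
      (hΩ.mem_nhds hx)).differentiableAt (by simp)
  have key : ∀ a b : Fin n, partialD a (partialD b f) x
      = -(fderiv ℝ (fderiv ℝ f) x (EuclideanSpace.single a 1) (EuclideanSpace.single b 1)) := by
    intro a b
    have h1 : DifferentiableAt ℝ (fun y => fderiv ℝ f y (EuclideanSpace.single b (1 : ℝ))) x :=
      hd.clm_apply (differentiableAt_const _)
    unfold partialD
    rw [fderiv_const_mul h1, fderiv_clm_apply hd (differentiableAt_const _)]
    simp [← mul_assoc]
  have hs : IsSymmSndFDerivAt ℝ f x :=
    (hf.contDiffAt (hΩ.mem_nhds hx)).isSymmSndFDerivAt (by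
      rw [minSmoothness_of_isRCLikeNormedField]
      exact WithTop.coe_le_coe.2 (le_top (a := (2 : ℕ∞))))
  rw [key, key, hs.eq]

end Derivatives

/-! ### Derivatives along words of directions -/

/-- The iterated derivative `D_{w₁} D_{w₂} ⋯ D_{wₘ} f` along a list of directions. -/
noncomputable def wordD {n : ℕ} (w : List (Fin n)) (f : Euc n → ℂ) : Euc n → ℂ :=
  w.foldr partialD f

/-- The sorted list of directions which contains `j` exactly `α j` times. -/
def multiIndexWord {n : ℕ} (α : Fin n → ℕ) : List (Fin n) :=
  (List.finRange n).flatMap fun j => List.replicate (α j) j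

section Words

variable {n : ℕ} {Ω : Set (Euc n)} {f g : Euc n → ℂ} {x : Euc n}

@[simp] theorem wordD_nil (f : Euc n → ℂ) : wordD [] f = f := rfl

@[simp] theorem wordD_cons (j : Fin n) (w : List (Fin n)) (f : Euc n → ℂ) :
    wordD (j :: w) f = partialD j (wordD w f) := rfl

theorem wordD_append (v w : List (Fin n)) (f : Euc n → ℂ) :
    wordD (v ++ w) f = wordD v (wordD w f) := by
  simp [wordD]

/-- Words replace multi-indices throughout, so that inductions peel off one derivative at a time. -/
theorem multiD_eq_wordD (α : Fin n → ℕ) (f : Euc n → ℂ) :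
    multiD α f = wordD (multiIndexWord α) f := by
  unfold multiD multiIndexWord
  have hrep : ∀ (k : ℕ) (j : Fin n) (g : Euc n → ℂ),
      (partialD j)^[k] g = wordD (List.replicate k j) g := by
    intro k j g
    induction k with
    | zero => rfl
    | succ k ih => rw [Function.iterate_succ_apply', ih, List.replicate_succ, wordD_cons]
  induction List.finRange n with
  | nil => rfl
  | cons j l ih => rw [List.foldr_cons, ih, hrep, List.flatMap_cons, wordD_append]

theorem count_multiIndexWord (α : Fin n → ℕ) (i : Fin n) :
    (multiIndexWord α).count i = α i := by
  unfold multiIndexWord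
  rw [List.count_flatMap]
  have : (List.map (List.count i ∘ fun j => List.replicate (α j) j) (List.finRange n)).sum
      = ∑ j, if j = i then α j else 0 := by
    rw [← List.sum_ofFn, List.ofFn_eq_map]
    congr 1
    apply List.map_congr_left
    intro j _
    simp [List.count_replicate]
  rw [this]
  simp

theorem length_eq_sum_count (w : List (Fin n)) : w.length = ∑ i, w.count i := by
  have := Multiset.toFinset_sum_count_eq (w : Multiset (Fin n))
  simp only [Multiset.coe_card, Multiset.coe_count] at this
  rw [← this]
  apply Finset.sum_subset (Finset.subset_univ _)
  intro i _ hi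
  simpa [List.count_eq_zero] using hi

theorem length_multiIndexWord (α : Fin n → ℕ) : (multiIndexWord α).length = ∑ i, α i := by
  rw [length_eq_sum_count]
  simp [count_multiIndexWord]

theorem wordD_contDiffOn (hΩ : IsOpen Ω) (hf : ContDiffOn ℝ ∞ f Ω) (w : List (Fin n)) :
    ContDiffOn ℝ ∞ (wordD w f) Ω := by
  induction w with
  | nil => exact hf
  | cons j w ih => exact partialD_contDiffOn hΩ ih j

theorem wordD_differentiableAt (hΩ : IsOpen Ω) (hf : ContDiffOn ℝ ∞ f Ω) (w : List (Fin n))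
    (hx : x ∈ Ω) : DifferentiableAt ℝ (wordD w f) x :=
  (wordD_contDiffOn hΩ hf w).differentiableAt_of_isOpen hΩ hx

theorem wordD_congr (hΩ : IsOpen Ω) (h : Set.EqOn f g Ω) (w : List (Fin n)) :
    Set.EqOn (wordD w f) (wordD w g) Ω := by
  induction w with
  | nil => exact h
  | cons j w ih => exact partialD_congr hΩ ih j

theorem wordD_add (hΩ : IsOpen Ω) (hf : ContDiffOn ℝ ∞ f Ω) (hg : ContDiffOn ℝ ∞ g Ω)
    (w : List (Fin n)) :
    Set.EqOn (wordD w fun y => f y + g y) (fun y => wordD w f y + wordD w g y) Ω := by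
  induction w with
  | nil => exact fun _ _ => rfl
  | cons j w ih =>
    intro x hx
    rw [wordD_cons, partialD_congr hΩ ih j hx, partialD_add_apply
      (wordD_differentiableAt hΩ hf w hx) (wordD_differentiableAt hΩ hg w hx)]
    rfl

theorem wordD_const_mul (hΩ : IsOpen Ω) (hf : ContDiffOn ℝ ∞ f Ω) (c : ℂ)
    (w : List (Fin n)) :
    Set.EqOn (wordD w fun y => c * f y) (fun y => c * wordD w f y) Ω := by
  induction w with
  | nil => exact fun _ _ => rfl
  | cons j w ih =>
    intro x hx
    rw [wordD_cons, partialD_congr hΩ ih j hx, partialD_const_mul_apply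
      (wordD_differentiableAt hΩ hf w hx)]
    rfl

theorem wordD_const (c : ℂ) (w : List (Fin n)) (hw : w ≠ []) :
    wordD w (fun _ : Euc n => c) = fun _ => 0 := by
  obtain ⟨v, j, rfl⟩ : ∃ v j, w = v ++ [j] := ⟨_, _, (List.dropLast_append_getLast hw).symm⟩
  rw [wordD_append, wordD_cons, wordD_nil, partialD_const]
  clear hw
  induction v with
  | nil => rfl
  | cons i v ih => rw [wordD_cons, ih, partialD_const]

theorem wordD_zero (w : List (Fin n)) : wordD w (fun _ : Euc n => 0) = fun _ => 0 := by
  by_cases hw : w = []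
  · rw [hw, wordD_nil]
  · exact wordD_const 0 w hw

theorem wordD_sum (hΩ : IsOpen Ω) {ι : Type*} (s : Finset ι) {F : ι → Euc n → ℂ}
    (hF : ∀ i ∈ s, ContDiffOn ℝ ∞ (F i) Ω) (w : List (Fin n)) :
    Set.EqOn (wordD w fun y => ∑ i ∈ s, F i y) (fun y => ∑ i ∈ s, wordD w (F i) y) Ω := by
  classical
  induction s using Finset.induction_on with
  | empty =>
    intro x _
    simp [wordD_zero]
  | insert a s ha ih =>
    intro x hx
    simp only [Finset.sum_insert ha]
    have hs : ∀ i ∈ s, ContDiffOn ℝ ∞ (F i) Ω := fun i hi => hF i (Finset.mem_insert_of_mem hi)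
    rw [wordD_add hΩ (hF a (Finset.mem_insert_self a s)) (ContDiffOn.sum hs) w hx]
    simp only
    rw [ih hs hx]

theorem wordD_perm (hΩ : IsOpen Ω) (hf : ContDiffOn ℝ ∞ f Ω) {v w : List (Fin n)}
    (h : v.Perm w) : Set.EqOn (wordD v f) (wordD w f) Ω := by
  induction h with
  | nil => exact fun _ _ => rfl
  | cons j _ ih => exact partialD_congr hΩ ih j
  | swap i j l => exact partialD_comm hΩ (wordD_contDiffOn hΩ hf l) j i
  | trans _ _ ih₁ ih₂ => exact ih₁.trans ih₂

theorem wordD_eq_multiD (hΩ : IsOpen Ω) (hf : ContDiffOn ℝ ∞ f Ω) (w : List (Fin n)) :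
    Set.EqOn (wordD w f) (multiD (fun i => w.count i) f) Ω := by
  rw [multiD_eq_wordD]
  apply wordD_perm hΩ hf
  rw [List.perm_iff_count]
  intro i
  rw [count_multiIndexWord]

/-- Leibniz rule with majorants that see only the length of a word. Distributing the innermost
derivative leaves two products of the same kind, with one majorant shifted, and Pascal's rule
recombines them. -/
theorem norm_wordD_mul_le (hΩ : IsOpen Ω) (hf : ContDiffOn ℝ ∞ f Ω)
    (hg : ContDiffOn ℝ ∞ g Ω) (hx : x ∈ Ω) {F G : ℕ → ℝ} (m : ℕ)
    (hF : ∀ w : List (Fin n), w.length ≤ m → ‖wordD w f x‖ ≤ F w.length)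
    (hG : ∀ w : List (Fin n), w.length ≤ m → ‖wordD w g x‖ ≤ G w.length)
    (w : List (Fin n)) (hw : w.length = m) :
    ‖wordD w (fun y => f y * g y) x‖
      ≤ ∑ i ∈ Finset.range (m + 1), (m.choose i : ℝ) * (F i * G (m - i)) := by
  induction m generalizing f g F G w with
  | zero =>
    rw [List.length_eq_zero_iff] at hw
    subst hw
    have h1 := hF [] le_rfl
    have h2 := hG [] le_rfl
    simp only [wordD_nil, List.length_nil] at h1 h2
    simp only [wordD_nil, norm_mul, zero_add, Finset.range_one, Finset.sum_singleton,
      Nat.choose_self, Nat.cast_one, one_mul, Nat.sub_zero]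
    exact mul_le_mul h1 h2 (norm_nonneg _) ((norm_nonneg _).trans h1)
  | succ m ih =>
    obtain ⟨v, j, rfl⟩ : ∃ v j, w = v ++ [j] :=
      ⟨_, _, (List.dropLast_append_getLast (by intro h; simp [h] at hw)).symm⟩
    have hv : v.length = m := by simpa using hw
    have hDf := partialD_contDiffOn hΩ hf j
    have hDg := partialD_contDiffOn hΩ hg j
    have hprod : Set.EqOn (wordD [j] fun y => f y * g y)
        (fun y => partialD j f y * g y + f y * partialD j g y) Ω := fun y hy =>
      partialD_mul_apply (hf.differentiableAt_of_isOpen hΩ hy)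
        (hg.differentiableAt_of_isOpen hΩ hy) j
    have hF' : ∀ w : List (Fin n), w.length ≤ m → ‖wordD w (partialD j f) x‖ ≤ F (w.length + 1) := by
      intro w hw
      have := hF (w ++ [j]) (by simp; omega)
      rwa [wordD_append, List.length_append] at this
    have hG' : ∀ w : List (Fin n), w.length ≤ m → ‖wordD w (partialD j g) x‖ ≤ G (w.length + 1) := by
      intro w hw
      have := hG (w ++ [j]) (by simp; omega)
      rwa [wordD_append, List.length_append] at this
    have hFm : ∀ w : List (Fin n), w.length ≤ m → ‖wordD w f x‖ ≤ F w.length :=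
      fun w hw => hF w (by omega)
    have hGm : ∀ w : List (Fin n), w.length ≤ m → ‖wordD w g x‖ ≤ G w.length :=
      fun w hw => hG w (by omega)
    have h1 := ih (F := fun i => F (i + 1)) hDf hg hF' hGm v hv
    have h2 := ih (G := fun i => G (i + 1)) hf hDg hFm hG' v hv
    rw [wordD_append, wordD_congr hΩ hprod v hx, wordD_add hΩ (hDf.mul hg) (hf.mul hDg) v hx]
    refine (norm_add_le _ _).trans ?_
    rw [Finset.sum_choose_succ_mul (fun i k => F i * G k), add_comm]
    refine add_le_add (h2.trans_eq ?_) h1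
    refine Finset.sum_congr rfl fun i hi => ?_
    rw [Nat.sub_add_comm (Finset.mem_range_succ_iff.1 hi)]

end Words

/-! ### Pointwise Gevrey bounds -/

/-- At the point `x` all derivatives of `f` satisfy Gevrey bounds of order `r` with constants
`A` and `h`. -/
def GevreyBoundAt {n : ℕ} (r A h : ℝ) (f : Euc n → ℂ) (x : Euc n) : Prop :=
  ∀ w : List (Fin n), ‖wordD w f x‖ ≤ A * h ^ w.length * ((w.length.factorial : ℕ) : ℝ) ^ r

section GevreyBoundAt

variable {n : ℕ} {Ω : Set (Euc n)} {f g : Euc n → ℂ} {x : Euc n} {r A B h k : ℝ}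

theorem GevreyBoundAt.nonneg (hf : GevreyBoundAt r A h f x) : 0 ≤ A := by
  simpa using (norm_nonneg _).trans (hf [])

theorem GevreyBoundAt.mono (hf : GevreyBoundAt r A h f x) (hAB : A ≤ B) (hh : 0 ≤ h)
    (hhk : h ≤ k) : GevreyBoundAt r B k f x := by
  intro w
  have hA := hf.nonneg
  have hB := hA.trans hAB
  refine (hf w).trans ?_
  gcongr

theorem one_le_factorial_rpow (hr : 0 ≤ r) (m : ℕ) : 1 ≤ ((m.factorial : ℕ) : ℝ) ^ r :=
  Real.one_le_rpow (by exact_mod_cast m.factorial_pos) hr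

theorem choose_mul_factorial_rpow_le (hr : 1 ≤ r) {m i : ℕ} (hi : i ≤ m) :
    (m.choose i : ℝ) * (((i.factorial : ℕ) : ℝ) ^ r * (((m - i).factorial : ℕ) : ℝ) ^ r)
      ≤ ((m.factorial : ℕ) : ℝ) ^ r := by
  have h1 : (1 : ℝ) ≤ m.choose i := by exact_mod_cast Nat.choose_pos hi
  calc (m.choose i : ℝ) * (((i.factorial : ℕ) : ℝ) ^ r * (((m - i).factorial : ℕ) : ℝ) ^ r)
      ≤ (m.choose i : ℝ) ^ r * (((i.factorial : ℕ) : ℝ) ^ r * (((m - i).factorial : ℕ) : ℝ) ^ r) := by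
        gcongr
        exact Real.self_le_rpow_of_one_le h1 hr
    _ = ((m.factorial : ℕ) : ℝ) ^ r := by
        rw [← Real.mul_rpow (by positivity) (by positivity),
          ← Real.mul_rpow (by positivity) (by positivity), ← Nat.choose_mul_factorial_mul_factorial hi]
        push_cast
        ring_nf

/-- `m.choose i * i!` is a descending factorial, a product of `i` factors at most `N`. Hence, with
at most `N` derivatives in play, each one on a Gevrey coefficient costs only a factor `Y`, Leibniz
binomials included. -/
theorem choose_mul_factorial_rpow_le_pow (hr : 1 ≤ r) {m i N : ℕ} {Y : ℝ} (hi : i ≤ m)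
    (hm : m ≤ N) (hY : (N : ℝ) ^ r ≤ Y) :
    (m.choose i : ℝ) * ((i.factorial : ℕ) : ℝ) ^ r ≤ Y ^ i := by
  have h1 : (1 : ℝ) ≤ m.choose i := by exact_mod_cast Nat.choose_pos hi
  calc (m.choose i : ℝ) * ((i.factorial : ℕ) : ℝ) ^ r
      ≤ (m.choose i : ℝ) ^ r * ((i.factorial : ℕ) : ℝ) ^ r := by
        gcongr
        exact Real.self_le_rpow_of_one_le h1 hr
    _ = ((m.descFactorial i : ℕ) : ℝ) ^ r := by
        rw [← Real.mul_rpow (by positivity) (by positivity),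
          Nat.descFactorial_eq_factorial_mul_choose]
        push_cast
        ring_nf
    _ ≤ ((N : ℝ) ^ i) ^ r := by
        gcongr
        exact_mod_cast (Nat.descFactorial_le_pow m i).trans (Nat.pow_le_pow_left hm i)
    _ = ((N : ℝ) ^ r) ^ i := by
        rw [← Real.rpow_natCast, ← Real.rpow_natCast, ← Real.rpow_mul (by positivity),
          ← Real.rpow_mul (by positivity), mul_comm]
    _ ≤ Y ^ i := by gcongr

theorem GevreyBoundAt.mul (hΩ : IsOpen Ω) (hf : ContDiffOn ℝ ∞ f Ω) (hg : ContDiffOn ℝ ∞ g Ω)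
    (hx : x ∈ Ω) (hr : 1 ≤ r) (hh : 0 ≤ h) (hA : GevreyBoundAt r A h f x)
    (hB : GevreyBoundAt r B h g x) :
    GevreyBoundAt r (A * B) (2 * h) (fun y => f y * g y) x := by
  intro w
  have hA0 := hA.nonneg
  have hB0 := hB.nonneg
  refine (norm_wordD_mul_le hΩ hf hg hx (F := fun i => A * h ^ i * ((i.factorial : ℕ) : ℝ) ^ r)
    (G := fun i => B * h ^ i * ((i.factorial : ℕ) : ℝ) ^ r) w.length (fun v _ => hA v)
    (fun v _ => hB v) w rfl).trans ?_
  set m := w.length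
  calc ∑ i ∈ Finset.range (m + 1), (m.choose i : ℝ) * (A * h ^ i * ((i.factorial : ℕ) : ℝ) ^ r *
        (B * h ^ (m - i) * (((m - i).factorial : ℕ) : ℝ) ^ r))
      ≤ ∑ _i ∈ Finset.range (m + 1), A * B * h ^ m * ((m.factorial : ℕ) : ℝ) ^ r := by
        refine Finset.sum_le_sum fun i hi => ?_
        have him : i ≤ m := Finset.mem_range_succ_iff.1 hi
        have hpow : h ^ m = h ^ i * h ^ (m - i) := by rw [← pow_add, Nat.add_sub_cancel' him]
        have := mul_le_mul_of_nonneg_left (choose_mul_factorial_rpow_le hr him)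
          (by positivity : 0 ≤ A * B * h ^ m)
        refine le_trans (le_of_eq ?_) this
        rw [hpow]
        ring
    _ = ((m + 1 : ℕ) : ℝ) * (A * B * h ^ m * ((m.factorial : ℕ) : ℝ) ^ r) := by
        rw [Finset.sum_const, Finset.card_range, nsmul_eq_mul]
    -- The `m + 1` Leibniz terms are absorbed by doubling `h`.
    _ ≤ 2 ^ m * (A * B * h ^ m * ((m.factorial : ℕ) : ℝ) ^ r) := by
        gcongr
        exact_mod_cast Nat.lt_two_pow_self
    _ = A * B * (2 * h) ^ m * ((m.factorial : ℕ) : ℝ) ^ r := by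
        rw [mul_pow]
        ring

theorem GevreyBoundAt.sum (hΩ : IsOpen Ω) {ι : Type*} {s : Finset ι} {F : ι → Euc n → ℂ}
    {a : ι → ℝ} (hF : ∀ i ∈ s, ContDiffOn ℝ ∞ (F i) Ω) (hx : x ∈ Ω)
    (hb : ∀ i ∈ s, GevreyBoundAt r (a i) h (F i) x) :
    GevreyBoundAt r (∑ i ∈ s, a i) h (fun y => ∑ i ∈ s, F i y) x := by
  intro w
  rw [wordD_sum hΩ s hF w hx, Finset.sum_mul, Finset.sum_mul]
  exact (norm_sum_le _ _).trans (Finset.sum_le_sum fun i hi => hb i hi w)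

theorem GevreyBoundAt.const (hh : 0 ≤ h) (c : ℂ) :
    GevreyBoundAt r ‖c‖ h (fun _ => c) x := by
  intro w
  rcases eq_or_ne w [] with rfl | hw
  · simp
  · rw [wordD_const c w hw]
    simp only [norm_zero]
    positivity

theorem IsGevrey.gevreyBoundAt (hΩ : IsOpen Ω) (hf : IsGevrey r Ω f) {K : Set (Euc n)}
    (hK : IsCompact K) (hKΩ : K ⊆ Ω) :
    ∃ A, 0 < A ∧ ∃ h, 0 < h ∧ ∀ x ∈ K, GevreyBoundAt r A h f x := by
  obtain ⟨A, hA, h, hh, hb⟩ := hf.2 K hK hKΩ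
  refine ⟨A, hA, h, hh, fun x hx w => ?_⟩
  rw [wordD_eq_multiD hΩ hf.1 w (hKΩ hx), length_eq_sum_count]
  exact hb _ x hx

end GevreyBoundAt

/-! ### Weighted bounds for derivatives up to a fixed order -/

/-- The parameters of a scale of weights for the derivatives of order at most `N`: `Y` is the cost
of a derivative that falls on a Gevrey coefficient, `Λ` is the cost of a derivative that falls on
an exponential factor, and `t` is the gain from a vanishing coefficient. -/
structure DerivWeight where
  /-- the Gevrey order of the coefficients -/
  r : ℝ
  /-- the Gevrey constant of the coefficients -/
  h : ℝ
  /-- the cost of differentiating a coefficient -/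
  Y : ℝ
  /-- the frequency -/
  Λ : ℝ
  /-- the gain -/
  t : ℝ
  /-- the maximal order of differentiation -/
  N : ℕ
  one_le_r : 1 ≤ r
  one_le_h : 1 ≤ h
  one_le_Y : 1 ≤ Y
  pow_le_Y : (N : ℝ) ^ r ≤ Y
  t_nonneg : 0 ≤ t
  t_le_one : t ≤ 1
  -- The balance behind all estimates: a derivative of the amplitude costs about `Y / t`, and this
  -- relation makes that at most `t * Λ`, the cost of a derivative on the exponential improved by
  -- one gain.
  Y_le : Y ≤ t ^ 2 * Λ

namespace DerivWeight

variable (W : DerivWeight) {n : ℕ} {Ω : Set (Euc n)} {f g : Euc n → ℂ} {x : Euc n}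
  {κ T : ℕ} {c c' A : ℝ}

/-- The derivatives of `g` at `x` of order `m ≤ T` are bounded by `c (2hY)^m t^(κ - m)`. -/
def Bound (κ T : ℕ) (c : ℝ) (g : Euc n → ℂ) (x : Euc n) : Prop :=
  -- `κ` counts the gains collected so far. A derivative may destroy one of them, and the truncated
  -- subtraction records that no more than `κ` can be lost.
  ∀ w : List (Fin n), w.length ≤ T →
    ‖wordD w g x‖ ≤ c * (2 * W.h * W.Y) ^ w.length * W.t ^ (κ - w.length)

theorem Λ_nonneg : 0 ≤ W.Λ := by
  have h1 := W.one_le_Y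
  have h2 := W.Y_le
  by_contra h
  nlinarith [sq_nonneg W.t]

theorem one_le_t_mul_Λ : 1 ≤ W.t * W.Λ := by
  have h1 := W.one_le_Y
  have h2 := W.Y_le
  nlinarith [mul_nonneg (mul_nonneg W.t_nonneg W.Λ_nonneg) (sub_nonneg.2 W.t_le_one)]

theorem one_le_Λ : 1 ≤ W.Λ := by
  have h1 := W.one_le_t_mul_Λ
  nlinarith [mul_nonneg W.Λ_nonneg (sub_nonneg.2 W.t_le_one)]

theorem hY_nonneg : 0 ≤ 2 * W.h * W.Y := by
  have h1 := W.one_le_Y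
  have h2 := W.one_le_h
  positivity

variable {W}

theorem Bound.nonneg (hg : W.Bound κ T c g x) : 0 ≤ c := by
  have h := (norm_nonneg _).trans (hg [] (Nat.zero_le _))
  simp only [List.length_nil, pow_zero, mul_one, Nat.sub_zero] at h
  have ht : 0 < W.t := by
    rcases W.t_nonneg.eq_or_lt with h0 | h0
    · have := W.one_le_t_mul_Λ
      rw [← h0] at this
      norm_num at this
    · exact h0
  exact nonneg_of_mul_nonneg_left h (pow_pos ht _)

theorem Bound.mono (hg : W.Bound κ T c g x) (hc : c ≤ c') : W.Bound κ T c' g x := by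
  intro w hw
  have h1 := W.hY_nonneg
  have h2 := W.t_nonneg
  refine (hg w hw).trans ?_
  gcongr

theorem Bound.anti {T' : ℕ} (hg : W.Bound κ T c g x) (hT : T' ≤ T) : W.Bound κ T' c g x :=
  fun w hw => hg w (hw.trans hT)

theorem Bound.of_succ (hg : W.Bound (κ + 1) T c g x) : W.Bound κ T c g x := by
  intro w hw
  have h0 := hg.nonneg
  have h1 := W.hY_nonneg
  refine (hg w hw).trans ?_
  have : W.t ^ (κ + 1 - w.length) ≤ W.t ^ (κ - w.length) :=
    pow_le_pow_of_le_one W.t_nonneg W.t_le_one (by omega)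
  gcongr

/-- Since `1 ≤ t * Λ`, an unused power of `Λ` buys a gain; this handles the terms of `P` of lower
order. -/
theorem Bound.gain (hg : W.Bound κ T c g x) : W.Bound (κ + 1) T (W.Λ * c) g x := by
  intro w hw
  have h0 := hg.nonneg
  have h1 := W.hY_nonneg
  have h2 := W.Λ_nonneg
  have ht := W.t_nonneg
  refine (hg w hw).trans ?_
  have : W.t ^ (κ - w.length) ≤ W.Λ * W.t ^ (κ + 1 - w.length) :=
    calc W.t ^ (κ - w.length) ≤ (W.t * W.Λ) * W.t ^ (κ - w.length) :=
          le_mul_of_one_le_left (pow_nonneg ht _) W.one_le_t_mul_Λ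
      _ = W.Λ * W.t ^ (κ - w.length + 1) := by ring
      _ ≤ W.Λ * W.t ^ (κ + 1 - w.length) :=
          mul_le_mul_of_nonneg_left
            (pow_le_pow_of_le_one ht W.t_le_one (by omega)) h2
  calc c * (2 * W.h * W.Y) ^ w.length * W.t ^ (κ - w.length)
      ≤ c * (2 * W.h * W.Y) ^ w.length * (W.Λ * W.t ^ (κ + 1 - w.length)) := by gcongr
    _ = _ := by ring

theorem Bound.congr (hΩ : IsOpen Ω) (hx : x ∈ Ω) (hfg : Set.EqOn f g Ω)
    (hf : W.Bound κ T c f x) : W.Bound κ T c g x := by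
  intro w hw
  rw [← wordD_congr hΩ hfg w hx]
  exact hf w hw

theorem Bound.add (hΩ : IsOpen Ω) (hf : ContDiffOn ℝ ∞ f Ω) (hg : ContDiffOn ℝ ∞ g Ω)
    (hx : x ∈ Ω) (hcf : W.Bound κ T c f x) (hcg : W.Bound κ T c' g x) :
    W.Bound κ T (c + c') (fun y => f y + g y) x := by
  intro w hw
  rw [wordD_add hΩ hf hg w hx, add_mul, add_mul]
  exact (norm_add_le _ _).trans (add_le_add (hcf w hw) (hcg w hw))

theorem Bound.sum (hΩ : IsOpen Ω) {ι : Type*} {s : Finset ι} {F : ι → Euc n → ℂ}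
    {a : ι → ℝ} (hF : ∀ i ∈ s, ContDiffOn ℝ ∞ (F i) Ω) (hx : x ∈ Ω)
    (hb : ∀ i ∈ s, W.Bound κ T (a i) (F i) x) :
    W.Bound κ T (∑ i ∈ s, a i) (fun y => ∑ i ∈ s, F i y) x := by
  intro w hw
  rw [wordD_sum hΩ s hF w hx, Finset.sum_mul, Finset.sum_mul]
  exact (norm_sum_le _ _).trans (Finset.sum_le_sum fun i hi => hb i hi w hw)

theorem Bound.const_mul (hΩ : IsOpen Ω) (hg : ContDiffOn ℝ ∞ g Ω) (hx : x ∈ Ω)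
    (hcg : W.Bound κ T c g x) (a : ℂ) : W.Bound κ T (‖a‖ * c) (fun y => a * g y) x := by
  intro w hw
  rw [wordD_const_mul hΩ hg a w hx, norm_mul, mul_assoc, mul_assoc, ← mul_assoc c]
  exact mul_le_mul_of_nonneg_left (hcg w hw) (norm_nonneg _)

/-- The extra derivative costs `2hY` and one power of `t`. By `Y ≤ t ^ 2 * Λ` that power is repaid
and one more is left over, so differentiating the amplitude costs `Λ` and earns a gain. -/
theorem Bound.partialD (hg : W.Bound κ (T + 1) c g x) (j : Fin n) :
    W.Bound (κ + 1) T (2 * W.h * W.Λ * c) (partialD j g) x := by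
  intro w hw
  have h0 := hg.nonneg
  have h1 := W.hY_nonneg
  have hh := W.one_le_h
  have hΛ := W.Λ_nonneg
  have ht := W.t_nonneg
  have := hg (w ++ [j]) (by simpa using hw)
  rw [wordD_append, List.length_append, List.length_singleton] at this
  refine this.trans ?_
  have hpow : W.t ^ 2 * W.t ^ (κ - (w.length + 1)) ≤ W.t ^ (κ + 1 - w.length) := by
    rw [← pow_add]
    exact pow_le_pow_of_le_one ht W.t_le_one (by omega)
  calc c * (2 * W.h * W.Y) ^ (w.length + 1) * W.t ^ (κ - (w.length + 1))
      = (2 * W.h * c * (2 * W.h * W.Y) ^ w.length * W.t ^ (κ - (w.length + 1))) * W.Y := by ring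
    _ ≤ (2 * W.h * c * (2 * W.h * W.Y) ^ w.length * W.t ^ (κ - (w.length + 1)))
          * (W.t ^ 2 * W.Λ) := by
        gcongr
        exact W.Y_le
    _ = 2 * W.h * W.Λ * c * (2 * W.h * W.Y) ^ w.length
          * (W.t ^ 2 * W.t ^ (κ - (w.length + 1))) := by ring
    _ ≤ 2 * W.h * W.Λ * c * (2 * W.h * W.Y) ^ w.length * W.t ^ (κ + 1 - w.length) := by
        gcongr

/-- If `i` derivatives fall on `f`, they cost `(hY)^i`, which is `2^(-i)` times the allowance
`(2hY)^i`; the geometric series then sums to the factor `2`. The term `i = 0` is kept apart because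
only there can smallness of `f x` be used. -/
theorem Bound.mul_aux (hΩ : IsOpen Ω) (hf : ContDiffOn ℝ ∞ f Ω) (hg : ContDiffOn ℝ ∞ g Ω)
    (hx : x ∈ Ω) (hT : T ≤ W.N) (hA : GevreyBoundAt W.r A W.h f x) {a : ℝ} {κ' : ℕ}
    (ha : ‖f x‖ ≤ A * a) (hcg : W.Bound κ T c g x)
    (h0 : ∀ m, a * W.t ^ (κ - m) ≤ W.t ^ (κ' - m))
    (h1 : ∀ m i, 0 < i → i ≤ m → W.t ^ (κ - (m - i)) ≤ W.t ^ (κ' - m)) :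
    W.Bound κ' T (2 * A * c) (fun y => f y * g y) x := by
  intro w hw
  have hA0 := hA.nonneg
  have hc0 := hcg.nonneg
  have hh := W.one_le_h
  have hY := W.one_le_Y
  have ht := W.t_nonneg
  refine (norm_wordD_mul_le hΩ hf hg hx
    (F := fun i => if i = 0 then A * a else A * W.h ^ i * ((i.factorial : ℕ) : ℝ) ^ W.r)
    (G := fun i => c * (2 * W.h * W.Y) ^ i * W.t ^ (κ - i)) w.length ?_
    (fun v hv => hcg v (hv.trans hw)) w rfl).trans ?_
  · intro v _
    split_ifs with hv
    · rw [List.length_eq_zero_iff] at hv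
      subst hv
      exact ha
    · exact hA v
  set m := w.length
  set S : ℝ := A * c * (2 * W.h * W.Y) ^ m * W.t ^ (κ' - m)
  calc ∑ i ∈ Finset.range (m + 1), (m.choose i : ℝ) *
        ((if i = 0 then A * a else A * W.h ^ i * ((i.factorial : ℕ) : ℝ) ^ W.r) *
          (c * (2 * W.h * W.Y) ^ (m - i) * W.t ^ (κ - (m - i))))
      ≤ ∑ i ∈ Finset.range (m + 1), S * (1 / 2) ^ i := by
        refine Finset.sum_le_sum fun i hi => ?_
        have him : i ≤ m := Finset.mem_range_succ_iff.1 hi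
        split_ifs with hi0
        · subst hi0
          have := mul_le_mul_of_nonneg_left (h0 m)
            (by positivity : 0 ≤ A * c * (2 * W.h * W.Y) ^ m)
          refine le_trans (le_of_eq ?_) (this.trans_eq ?_)
          · simp only [Nat.choose_zero_right, Nat.cast_one, Nat.sub_zero]
            ring
          · simp [S]
        · have e1 : (2 * W.h * W.Y) ^ m
              = W.h ^ i * W.Y ^ i * 2 ^ i * (2 * W.h * W.Y) ^ (m - i) := by
            rw [← mul_pow, ← mul_pow]
            nth_rw 1 [← Nat.add_sub_cancel' him]
            rw [pow_add]
            ring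
          have e2 := choose_mul_factorial_rpow_le_pow W.one_le_r him (hw.trans hT) W.pow_le_Y
          have e3 := h1 m i (Nat.pos_of_ne_zero hi0) him
          calc (m.choose i : ℝ) * (A * W.h ^ i * ((i.factorial : ℕ) : ℝ) ^ W.r *
                (c * (2 * W.h * W.Y) ^ (m - i) * W.t ^ (κ - (m - i))))
              = (A * c * W.h ^ i * (2 * W.h * W.Y) ^ (m - i)) *
                  (((m.choose i : ℝ) * ((i.factorial : ℕ) : ℝ) ^ W.r) * W.t ^ (κ - (m - i))) := by
                ring
            _ ≤ (A * c * W.h ^ i * (2 * W.h * W.Y) ^ (m - i)) *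
                  (W.Y ^ i * W.t ^ (κ' - m)) := by gcongr
            _ = S * (1 / 2) ^ i := by
                simp only [S]
                rw [e1, one_div, inv_pow]
                field_simp
    _ = S * ∑ i ∈ Finset.range (m + 1), (1 / 2 : ℝ) ^ i := by rw [Finset.mul_sum]
    _ ≤ S * 2 := by
        gcongr
        exact sum_geometric_two_le _
    _ = 2 * A * c * (2 * W.h * W.Y) ^ m * W.t ^ (κ' - m) := by
        simp only [S]
        ring

theorem Bound.mul (hΩ : IsOpen Ω) (hf : ContDiffOn ℝ ∞ f Ω) (hg : ContDiffOn ℝ ∞ g Ω)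
    (hx : x ∈ Ω) (hT : T ≤ W.N) (hA : GevreyBoundAt W.r A W.h f x)
    (hcg : W.Bound κ T c g x) : W.Bound κ T (2 * A * c) (fun y => f y * g y) x := by
  refine hcg.mul_aux hΩ hf hg hx hT hA (a := 1) (by simpa using hA []) (fun m => by simp) ?_
  exact fun m i _ _ => pow_le_pow_of_le_one W.t_nonneg W.t_le_one (by omega)

/-- A derivative that hits the small factor `f` destroys its smallness, but it is then one
derivative fewer on `g`, and the power of `t` thus spared makes up for the loss. -/
theorem Bound.mul_small (hΩ : IsOpen Ω) (hf : ContDiffOn ℝ ∞ f Ω) (hg : ContDiffOn ℝ ∞ g Ω)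
    (hx : x ∈ Ω) (hT : T ≤ W.N) (hA : GevreyBoundAt W.r A W.h f x) (hfx : ‖f x‖ ≤ A * W.t)
    (hcg : W.Bound κ T c g x) : W.Bound (κ + 1) T (2 * A * c) (fun y => f y * g y) x := by
  refine hcg.mul_aux hΩ hf hg hx hT hA hfx (fun m => ?_) fun m i _ _ =>
    pow_le_pow_of_le_one W.t_nonneg W.t_le_one (by omega)
  rw [← pow_succ']
  exact pow_le_pow_of_le_one W.t_nonneg W.t_le_one (by omega)

end DerivWeight

/-! ### Gaussian wave packets and the conjugated operator -/

section WavePacket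

variable {n : ℕ}

/-- The complex covector `ξ + i (x - x₀)`. -/
noncomputable def complexCovector (x₀ ξ : Euc n) (i : Fin n) (x : Euc n) : ℂ :=
  (ξ i : ℂ) + Complex.I * ((x i : ℂ) - (x₀ i : ℂ))

/-- The complex phase `i (x - x₀) · ξ - |x - x₀|² / 2`. -/
noncomputable def gaussianPhase (x₀ ξ x : Euc n) : ℂ :=
  ∑ i, (Complex.I * ((x i : ℂ) - (x₀ i : ℂ)) * (ξ i : ℂ) - ((x i : ℂ) - (x₀ i : ℂ)) ^ 2 / 2)

/-- The Gaussian wave packet `exp (i lam (x - x₀) · ξ - lam |x - x₀|² / 2)` of frequency `lam`. -/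
noncomputable def wavePacket (x₀ ξ : Euc n) (lam : ℝ) (x : Euc n) : ℂ :=
  Complex.exp ((lam : ℂ) * gaussianPhase x₀ ξ x)

/-- The derivative `D_j` conjugated with a wave packet. -/
noncomputable def twistD (x₀ ξ : Euc n) (lam : ℝ) (j : Fin n) (g : Euc n → ℂ) : Euc n → ℂ :=
  fun x => partialD j g x + ((lam : ℂ) * complexCovector x₀ ξ j x) * g x

/-- The derivative along a word conjugated with a wave packet. -/
noncomputable def twistWord (x₀ ξ : Euc n) (lam : ℝ) (w : List (Fin n)) (g : Euc n → ℂ) :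
    Euc n → ℂ :=
  w.foldr (twistD x₀ ξ lam) g

/-- The symbol of the derivative along a word, at the complex covector `ξ + i (x - x₀)`. -/
noncomputable def covectorWord (x₀ ξ : Euc n) (w : List (Fin n)) (x : Euc n) : ℂ :=
  (w.map fun i => complexCovector x₀ ξ i x).prod

variable {Ω : Set (Euc n)} {f g : Euc n → ℂ} {x x₀ ξ : Euc n} {lam : ℝ}

theorem hasFDerivAt_coord (i : Fin n) (x : Euc n) :
    HasFDerivAt (fun y : Euc n => (y i : ℂ))
      (Complex.ofRealCLM ∘L (EuclideanSpace.proj i : Euc n →L[ℝ] ℝ)) x :=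
  (Complex.ofRealCLM ∘L (EuclideanSpace.proj i : Euc n →L[ℝ] ℝ)).hasFDerivAt

theorem contDiff_coord (i : Fin n) : ContDiff ℝ ∞ (fun y : Euc n => (y i : ℂ)) :=
  (Complex.ofRealCLM ∘L (EuclideanSpace.proj i : Euc n →L[ℝ] ℝ)).contDiff

theorem contDiff_complexCovector (i : Fin n) : ContDiff ℝ ∞ (complexCovector x₀ ξ i) := by
  unfold complexCovector
  exact contDiff_const.add (contDiff_const.mul ((contDiff_coord i).sub contDiff_const))

theorem partialD_complexCovector (i j : Fin n) :
    partialD j (complexCovector x₀ ξ i) = fun _ => if i = j then 1 else 0 := by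
  funext x
  have h : HasFDerivAt (complexCovector x₀ ξ i) _ x :=
    (((hasFDerivAt_coord i x).sub_const (x₀ i : ℂ)).const_mul Complex.I).const_add (ξ i : ℂ)
  rw [partialD, h.fderiv]
  by_cases h : i = j
  · subst h; simp
  · simp [h]

theorem contDiff_gaussianPhase : ContDiff ℝ ∞ (gaussianPhase x₀ ξ) := by
  unfold gaussianPhase
  refine ContDiff.sum fun i _ => ?_
  have h := (contDiff_coord i).sub (contDiff_const (c := (x₀ i : ℂ)))
  exact ((contDiff_const.mul h).mul contDiff_const).sub ((h.pow 2).div_const 2)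

theorem contDiff_wavePacket : ContDiff ℝ ∞ (wavePacket x₀ ξ lam) :=
  (contDiff_const.mul contDiff_gaussianPhase).cexp

theorem partialD_gaussianPhase (j : Fin n) :
    partialD j (gaussianPhase x₀ ξ) = complexCovector x₀ ξ j := by
  funext x
  have h : HasFDerivAt (gaussianPhase x₀ ξ) _ x :=
    HasFDerivAt.fun_sum (u := Finset.univ) fun i _ =>
      ((((hasFDerivAt_coord i x).sub_const (x₀ i : ℂ)).const_mul Complex.I).mul_const
        (ξ i : ℂ)).sub ((((hasFDerivAt_coord i x).sub_const (x₀ i : ℂ)).pow 2).mul_const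
          (2⁻¹ : ℂ))
  rw [partialD, h.fderiv]
  simp only [complexCovector, FunLike.coe_sum, Finset.sum_apply]
  rw [Finset.sum_eq_single j]
  · simp
    ring_nf
    rw [Complex.I_sq]
    ring
  · intro i _ hi
    simp [hi]
  · simp

theorem partialD_wavePacket (j : Fin n) (x : Euc n) :
    partialD j (wavePacket x₀ ξ lam) x
      = (lam : ℂ) * complexCovector x₀ ξ j x * wavePacket x₀ ξ lam x := by
  have hd : DifferentiableAt ℝ (gaussianPhase x₀ ξ) x :=
    contDiff_gaussianPhase.differentiable (by simp) x
  have h : HasFDerivAt (wavePacket x₀ ξ lam) _ x := (hd.hasFDerivAt.const_mul (lam : ℂ)).cexp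
  have h2 := congrFun (partialD_gaussianPhase (x₀ := x₀) (ξ := ξ) j) x
  rw [← h2, partialD, partialD, h.fderiv]
  simp only [FunLike.coe_smul, Pi.smul_apply, smul_eq_mul, wavePacket]
  ring

theorem norm_wavePacket : ‖wavePacket x₀ ξ lam x‖ = Real.exp (-(lam * ‖x - x₀‖ ^ 2 / 2)) := by
  rw [wavePacket, Complex.norm_exp]
  congr 1
  rw [Complex.re_ofReal_mul, gaussianPhase, Complex.re_sum, EuclideanSpace.norm_sq_eq]
  have : ∀ i, (Complex.I * ((x i : ℂ) - (x₀ i : ℂ)) * (ξ i : ℂ)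
      - ((x i : ℂ) - (x₀ i : ℂ)) ^ 2 / 2).re = -(‖(x - x₀) i‖ ^ 2 / 2) := by
    intro i
    have h1 : (Complex.I * ((x i : ℂ) - (x₀ i : ℂ)) * (ξ i : ℂ)
        - ((x i : ℂ) - (x₀ i : ℂ)) ^ 2 / 2)
        = (((x i - x₀ i) * ξ i : ℝ) : ℂ) * Complex.I + ((-((x i - x₀ i) ^ 2 / 2) : ℝ) : ℂ) := by
      push_cast; ring
    rw [h1, Complex.add_re, Complex.re_ofReal_mul, Complex.I_re, Complex.ofReal_re,
      PiLp.sub_apply, Real.norm_eq_abs, sq_abs]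
    ring
  rw [Finset.sum_congr rfl fun i _ => this i, Finset.sum_neg_distrib, ← Finset.sum_div]
  ring

@[simp] theorem twistWord_nil (g : Euc n → ℂ) : twistWord x₀ ξ lam [] g = g := rfl

@[simp] theorem twistWord_cons (j : Fin n) (w : List (Fin n)) (g : Euc n → ℂ) :
    twistWord x₀ ξ lam (j :: w) g = twistD x₀ ξ lam j (twistWord x₀ ξ lam w g) := rfl

theorem twistD_contDiffOn (hΩ : IsOpen Ω) (hg : ContDiffOn ℝ ∞ g Ω) (j : Fin n) :
    ContDiffOn ℝ ∞ (twistD x₀ ξ lam j g) Ω :=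
  (partialD_contDiffOn hΩ hg j).add
    ((contDiffOn_const.mul (contDiff_complexCovector j).contDiffOn).mul hg)

theorem twistWord_contDiffOn (hΩ : IsOpen Ω) (hg : ContDiffOn ℝ ∞ g Ω) (w : List (Fin n)) :
    ContDiffOn ℝ ∞ (twistWord x₀ ξ lam w g) Ω := by
  induction w with
  | nil => exact hg
  | cons j w ih => exact twistD_contDiffOn hΩ ih j

theorem wordD_wavePacket_mul (hΩ : IsOpen Ω) (hg : ContDiffOn ℝ ∞ g Ω) (w : List (Fin n)) :
    Set.EqOn (wordD w fun y => wavePacket x₀ ξ lam y * g y)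
      (fun y => wavePacket x₀ ξ lam y * twistWord x₀ ξ lam w g y) Ω := by
  induction w with
  | nil => exact fun _ _ => rfl
  | cons j w ih =>
    intro x hx
    rw [wordD_cons, partialD_congr hΩ ih j hx,
      partialD_mul_apply (contDiff_wavePacket.differentiable (by simp) x)
        ((twistWord_contDiffOn hΩ hg w).differentiableAt_of_isOpen hΩ hx),
      partialD_wavePacket]
    simp only [twistWord_cons, twistD]
    ring

theorem contDiff_covectorWord (w : List (Fin n)) : ContDiff ℝ ∞ (covectorWord x₀ ξ w) := by
  induction w with
  | nil => exact contDiff_const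
  | cons j w ih =>
    have : covectorWord x₀ ξ (j :: w)
        = fun x => complexCovector x₀ ξ j x * covectorWord x₀ ξ w x := by
      funext x
      simp [covectorWord]
    rw [this]
    exact (contDiff_complexCovector j).mul ih

theorem covectorWord_multiIndexWord_self (α : Fin n → ℕ) :
    covectorWord x₀ ξ (multiIndexWord α) x₀ = ∏ i, ((ξ i : ℝ) : ℂ) ^ α i := by
  unfold covectorWord multiIndexWord
  rw [← List.prod_ofFn, List.ofFn_eq_map]
  induction List.finRange n with
  | nil => rfl
  | cons i l ih =>
    rw [List.flatMap_cons, List.map_append, List.prod_append, ih, List.map_cons, List.prod_cons]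
    simp [complexCovector]

theorem gevreyBoundAt_complexCovector {r A h : ℝ} (hr : 0 ≤ r) (hA : 1 ≤ A) (hh : 1 ≤ h)
    (i : Fin n) (hx : ‖complexCovector x₀ ξ i x‖ ≤ A) :
    GevreyBoundAt r A h (complexCovector x₀ ξ i) x := by
  intro w
  have h1 : 1 ≤ A * h ^ w.length * ((w.length.factorial : ℕ) : ℝ) ^ r := by
    have e1 := one_le_pow₀ hh (n := w.length)
    have e2 := one_le_factorial_rpow hr w.length
    exact one_le_mul_of_one_le_of_one_le (one_le_mul_of_one_le_of_one_le hA e1) e2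
  rcases eq_or_ne w [] with rfl | hw
  · simpa using hx
  · obtain ⟨v, j, rfl⟩ : ∃ v j, w = v ++ [j] := ⟨_, _, (List.dropLast_append_getLast hw).symm⟩
    rw [wordD_append, wordD_cons, wordD_nil, partialD_complexCovector]
    refine le_trans ?_ h1
    rcases eq_or_ne v [] with rfl | hv
    · rw [wordD_nil]
      split_ifs <;> simp
    · rw [wordD_const _ v hv]
      simp

end WavePacket

/-! ### Weighted bounds for conjugated derivatives. -/

section TwistBounds

open DerivWeight

variable {n : ℕ} {Ω : Set (Euc n)} {g : Euc n → ℂ} {x x₀ ξ : Euc n} {lam : ℝ}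
  {W : DerivWeight} {κ T : ℕ} {c A : ℝ}

theorem DerivWeight.Bound.covector_mul (hΩ : IsOpen Ω) (hg : ContDiffOn ℝ ∞ g Ω) (hx : x ∈ Ω)
    (hl : |lam| ≤ W.Λ) (hA : ∀ i, GevreyBoundAt W.r A W.h (complexCovector x₀ ξ i) x)
    (hT : T ≤ W.N) (hcg : W.Bound κ T c g x) (j : Fin n) :
    W.Bound κ T (2 * A * W.Λ * c)
      (fun y => ((lam : ℂ) * complexCovector x₀ ξ j y) * g y) x := by
  have hA0 := (hA j).nonneg
  have hc0 := hcg.nonneg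
  have hη := (contDiff_complexCovector (x₀ := x₀) (ξ := ξ) j).contDiffOn (s := Ω)
  have h := (hcg.mul hΩ hη hg hx hT (hA j)).const_mul hΩ (hη.mul hg) hx (lam : ℂ)
  simp only [← mul_assoc] at h ⊢
  refine h.mono ?_
  rw [Complex.norm_real, Real.norm_eq_abs]
  calc |lam| * 2 * A * c = |lam| * (2 * A * c) := by ring
    _ ≤ W.Λ * (2 * A * c) := by gcongr
    _ = 2 * A * W.Λ * c := by ring

theorem DerivWeight.Bound.twistD (hΩ : IsOpen Ω) (hg : ContDiffOn ℝ ∞ g Ω) (hx : x ∈ Ω)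
    (hl : |lam| ≤ W.Λ) (hA : ∀ i, GevreyBoundAt W.r A W.h (complexCovector x₀ ξ i) x)
    (hT : T + 1 ≤ W.N) (hcg : W.Bound κ (T + 1) c g x) (j : Fin n) :
    W.Bound κ T ((2 * W.h + 2 * A) * W.Λ * c) (twistD x₀ ξ lam j g) x := by
  have h1 := (hcg.partialD j).of_succ
  have h2 := (hcg.anti T.le_succ).covector_mul hΩ hg hx hl hA (by omega) j
  refine (h1.add hΩ (partialD_contDiffOn hΩ hg j)
    ((contDiffOn_const.mul (contDiff_complexCovector j).contDiffOn).mul hg) hx h2).mono ?_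
  exact le_of_eq (by ring)

theorem DerivWeight.Bound.twistWord (hΩ : IsOpen Ω) (hg : ContDiffOn ℝ ∞ g Ω) (hx : x ∈ Ω)
    (hl : |lam| ≤ W.Λ) (hA : ∀ i, GevreyBoundAt W.r A W.h (complexCovector x₀ ξ i) x)
    (w : List (Fin n)) (hT : T + w.length ≤ W.N) (hcg : W.Bound κ (T + w.length) c g x) :
    W.Bound κ T (((2 * W.h + 2 * A) * W.Λ) ^ w.length * c) (twistWord x₀ ξ lam w g) x := by
  induction w generalizing T with
  | nil => simpa using hcg
  | cons j w ih =>
    rw [List.length_cons] at hT hcg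
    have h := ih (T := T + 1) (by omega) (hcg.anti (by omega))
    refine (h.twistD hΩ (twistWord_contDiffOn hΩ hg w) hx hl hA (by omega) j).mono ?_
    rw [List.length_cons]
    exact le_of_eq (by ring)

/-- In the expansion of the product of the factors `D_j + lam η_j`, every term other than the pure
symbol contains a derivative of the amplitude or of a covector component, and such a derivative
earns a gain. -/
theorem DerivWeight.Bound.twistWord_sub (hΩ : IsOpen Ω) (hg : ContDiffOn ℝ ∞ g Ω) (hx : x ∈ Ω)
    (hl : |lam| ≤ W.Λ) (hA : ∀ i, GevreyBoundAt W.r A W.h (complexCovector x₀ ξ i) x)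
    (w : List (Fin n)) (hT : T + w.length ≤ W.N) (hcg : W.Bound κ (T + w.length) c g x) :
    W.Bound (κ + 1) T (((2 * W.h + 2 * A) * W.Λ) ^ w.length * c)
      (fun y => _root_.twistWord x₀ ξ lam w g y
        - (lam : ℂ) ^ w.length * covectorWord x₀ ξ w y * g y) x := by
  have hc0 := hcg.nonneg
  induction w generalizing T with
  | nil =>
    intro v _
    have h1 := W.hY_nonneg
    have h2 := W.t_nonneg
    simp only [twistWord_nil, List.length_nil, pow_zero, covectorWord, List.map_nil,
      List.prod_nil, mul_one, one_mul, sub_self, wordD_zero, norm_zero]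
    positivity
  | cons j w ih =>
    rw [List.length_cons] at hT hcg
    have hw := twistWord_contDiffOn (x₀ := x₀) (ξ := ξ) (lam := lam) hΩ hg w
    have h1 := (hcg.anti (by omega : T + 1 + w.length ≤ _)).twistWord hΩ hg hx hl hA w
      (by omega)
    have h2 := ih (T := T) (by omega) (hcg.anti (by omega))
    have hsm : ContDiffOn ℝ ∞ (fun y => _root_.twistWord x₀ ξ lam w g y
        - (lam : ℂ) ^ w.length * covectorWord x₀ ξ w y * g y) Ω :=
      hw.sub ((contDiffOn_const.mul (contDiff_covectorWord w).contDiffOn).mul hg)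
    have h3 := h2.covector_mul hΩ hsm hx hl hA (by omega) j
    have h4 := (h1.partialD j).add hΩ (partialD_contDiffOn hΩ hw j)
      ((contDiffOn_const.mul (contDiff_complexCovector j).contDiffOn).mul hsm) hx h3
    refine (h4.congr hΩ hx ?_).mono ?_
    · intro y _
      simp only [twistWord_cons, _root_.twistD, List.length_cons, covectorWord, List.map_cons,
        List.prod_cons]
      ring
    · rw [List.length_cons]
      exact le_of_eq (by ring)

end TwistBounds

/-! ### The differential operator conjugated with a wave packet -/

namespace LinDiffOp

variable {n : ℕ} (P : LinDiffOp n) {Ω : Set (Euc n)} {f g : Euc n → ℂ} {x x₀ ξ : Euc n} {lam : ℝ}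

/-- The operator `P` conjugated with a wave packet. -/
noncomputable def conj (x₀ ξ : Euc n) (lam : ℝ) (g : Euc n → ℂ) : Euc n → ℂ :=
  fun x => ∑ l ∈ Finset.range (P.order + 1),
    ∑ α ∈ Finset.piAntidiag (Finset.univ : Finset (Fin n)) l,
      P.coeff α x * twistWord x₀ ξ lam (multiIndexWord α) g x

/-- The principal symbol of `P` along the complex covector field `ξ + i (x - x₀)`. -/
noncomputable def covectorSymbol (x₀ ξ : Euc n) : Euc n → ℂ :=
  fun x => ∑ α ∈ Finset.piAntidiag (Finset.univ : Finset (Fin n)) P.order,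
    P.coeff α x * covectorWord x₀ ξ (multiIndexWord α) x

/-- The coefficients of `P` are smooth in `Ω`. -/
def HasSmoothCoeffs (Ω : Set (Euc n)) : Prop :=
  ∀ α : Fin n → ℕ, ∑ i, α i ≤ P.order → ContDiffOn ℝ ∞ (P.coeff α) Ω

variable {P}

theorem sum_le_of_mem {l : ℕ} (hl : l ∈ Finset.range (P.order + 1)) {α : Fin n → ℕ}
    (hα : α ∈ Finset.piAntidiag (Finset.univ : Finset (Fin n)) l) :
    ∑ i, α i = l ∧ ∑ i, α i ≤ P.order := by
  have h1 := (Finset.mem_piAntidiag.1 hα).1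
  exact ⟨h1, h1.trans_le (Finset.mem_range_succ_iff.1 hl)⟩

theorem sum_le_of_mem_order {α : Fin n → ℕ}
    (hα : α ∈ Finset.piAntidiag (Finset.univ : Finset (Fin n)) P.order) :
    ∑ i, α i = P.order :=
  (Finset.mem_piAntidiag.1 hα).1

theorem apply_contDiffOn (hΩ : IsOpen Ω) (hP : P.HasSmoothCoeffs Ω) (hf : ContDiffOn ℝ ∞ f Ω) :
    ContDiffOn ℝ ∞ (P.apply f) Ω := by
  unfold apply
  refine ContDiffOn.sum fun l hl => ContDiffOn.sum fun α hα => ?_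
  simp only [multiD_eq_wordD]
  exact (hP α (sum_le_of_mem hl hα).2).mul (wordD_contDiffOn hΩ hf _)

theorem conj_contDiffOn (hΩ : IsOpen Ω) (hP : P.HasSmoothCoeffs Ω) (hg : ContDiffOn ℝ ∞ g Ω) :
    ContDiffOn ℝ ∞ (P.conj x₀ ξ lam g) Ω := by
  unfold conj
  refine ContDiffOn.sum fun l hl => ContDiffOn.sum fun α hα => ?_
  exact (hP α (sum_le_of_mem hl hα).2).mul (twistWord_contDiffOn hΩ hg _)

theorem covectorSymbol_contDiffOn (hP : P.HasSmoothCoeffs Ω) :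
    ContDiffOn ℝ ∞ (P.covectorSymbol x₀ ξ) Ω := by
  unfold covectorSymbol
  refine ContDiffOn.sum fun α hα => ?_
  exact (hP α (sum_le_of_mem_order hα).le).mul (contDiff_covectorWord _).contDiffOn

/-- At the centre of the packet the covector is the real `ξ`, so a characteristic point makes the
leading coefficient vanish there. -/
theorem covectorSymbol_self : P.covectorSymbol x₀ ξ x₀ = P.principalSymbol x₀ ξ := by
  simp only [covectorSymbol, principalSymbol, covectorWord_multiIndexWord_self]

theorem apply_congr (hΩ : IsOpen Ω) (h : Set.EqOn f g Ω) :
    Set.EqOn (P.apply f) (P.apply g) Ω := by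
  intro x hx
  simp only [apply, multiD_eq_wordD]
  exact Finset.sum_congr rfl fun l _ => Finset.sum_congr rfl fun α _ => by
    rw [wordD_congr hΩ h _ hx]

theorem apply_wavePacket_mul (hΩ : IsOpen Ω) (hg : ContDiffOn ℝ ∞ g Ω) :
    Set.EqOn (P.apply fun y => wavePacket x₀ ξ lam y * g y)
      (fun y => wavePacket x₀ ξ lam y * P.conj x₀ ξ lam g y) Ω := by
  intro x hx
  simp only [apply, conj, multiD_eq_wordD, Finset.mul_sum]
  refine Finset.sum_congr rfl fun l _ => Finset.sum_congr rfl fun α _ => ?_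
  rw [wordD_wavePacket_mul hΩ hg _ hx]
  ring

theorem iterate_conj_contDiffOn (hΩ : IsOpen Ω) (hP : P.HasSmoothCoeffs Ω)
    (hg : ContDiffOn ℝ ∞ g Ω) (k : ℕ) : ContDiffOn ℝ ∞ ((P.conj x₀ ξ lam)^[k] g) Ω := by
  induction k with
  | zero => exact hg
  | succ k ih =>
    rw [Function.iterate_succ_apply']
    exact conj_contDiffOn hΩ hP ih

theorem iterate_apply_contDiffOn (hΩ : IsOpen Ω) (hP : P.HasSmoothCoeffs Ω)
    (hf : ContDiffOn ℝ ∞ f Ω) (k : ℕ) : ContDiffOn ℝ ∞ (P.apply^[k] f) Ω := by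
  induction k with
  | zero => exact hf
  | succ k ih =>
    rw [Function.iterate_succ_apply']
    exact apply_contDiffOn hΩ hP ih

theorem iterate_apply_wavePacket (hΩ : IsOpen Ω) (hP : P.HasSmoothCoeffs Ω) (k : ℕ) :
    Set.EqOn (P.apply^[k] (wavePacket x₀ ξ lam))
      (fun y => wavePacket x₀ ξ lam y * (P.conj x₀ ξ lam)^[k] (fun _ => 1) y) Ω := by
  induction k with
  | zero =>
    intro x _
    simp
  | succ k ih =>
    intro x hx
    rw [Function.iterate_succ_apply', Function.iterate_succ_apply', apply_congr hΩ ih hx,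
      apply_wavePacket_mul hΩ (iterate_conj_contDiffOn hΩ hP contDiffOn_const k) hx]

/-! ### Weighted bounds for the conjugated operator and its iterates. -/

section Bounds

open DerivWeight

variable {W : DerivWeight} {κ T : ℕ} {c A B : ℝ}

variable (P) in
/-- The constant in the estimate of the conjugated operator. -/
noncomputable def conjConst (h A B : ℝ) : ℝ :=
  2 * B + ∑ l ∈ Finset.range (P.order + 1),
    ∑ _α ∈ Finset.piAntidiag (Finset.univ : Finset (Fin n)) l, 2 * A * (2 * h + 2 * A) ^ P.order

/-- One application costs `Λ ^ P.order` and earns one gain, from three sources: the symbol is of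
size `t`, the rest of the top order part contains a derivative, and the lower order part has a power
of `Λ` to spare. -/
theorem bound_conj (hΩ : IsOpen Ω) (hP : P.HasSmoothCoeffs Ω) (hg : ContDiffOn ℝ ∞ g Ω)
    (hx : x ∈ Ω) (hl : |lam| ≤ W.Λ)
    (hη : ∀ i, GevreyBoundAt W.r A W.h (complexCovector x₀ ξ i) x)
    (hA : ∀ α : Fin n → ℕ, ∑ i, α i ≤ P.order → GevreyBoundAt W.r A W.h (P.coeff α) x)
    (hB : GevreyBoundAt W.r B W.h (P.covectorSymbol x₀ ξ) x)
    (hBt : ‖P.covectorSymbol x₀ ξ x‖ ≤ B * W.t)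
    (hT : T + P.order ≤ W.N) (hcg : W.Bound κ (T + P.order) c g x) :
    W.Bound (κ + 1) T (P.conjConst W.h A B * W.Λ ^ P.order * c) (P.conj x₀ ξ lam g) x := by
  set d := P.order with hd
  have hA0 : 0 ≤ A := (hA 0 (by simp)).nonneg
  have hB0 := hB.nonneg
  have hc0 := hcg.nonneg
  have hΛ := W.one_le_Λ
  have hh := W.one_le_h
  have hC : 1 ≤ 2 * W.h + 2 * A := by linarith
  have hsym := covectorSymbol_contDiffOn (x₀ := x₀) (ξ := ξ) hP
  have hlam : ‖(lam : ℂ) ^ d‖ ≤ W.Λ ^ d := by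
    rw [norm_pow, Complex.norm_real, Real.norm_eq_abs]
    gcongr
  -- What remains of each term once the leading symbol is split off; only words of full length `d`
  -- contribute to that symbol.
  let R : ℕ → (Fin n → ℕ) → Euc n → ℂ := fun l α y =>
    if l = d then twistWord x₀ ξ lam (multiIndexWord α) g y
      - (lam : ℂ) ^ (multiIndexWord α).length * covectorWord x₀ ξ (multiIndexWord α) y * g y
    else twistWord x₀ ξ lam (multiIndexWord α) g y
  have hRsm : ∀ l α, ContDiffOn ℝ ∞ (R l α) Ω := by
    intro l α
    have h1 := twistWord_contDiffOn (x₀ := x₀) (ξ := ξ) (lam := lam) hΩ hg (multiIndexWord α)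
    by_cases hld : l = d
    · simp only [R, hld, if_true]
      exact h1.sub ((contDiffOn_const.mul (contDiff_covectorWord _).contDiffOn).mul hg)
    · simp only [R, hld, if_false]
      exact h1
  have hR : ∀ l ∈ Finset.range (d + 1),
      ∀ α ∈ Finset.piAntidiag (Finset.univ : Finset (Fin n)) l,
      W.Bound (κ + 1) T ((2 * W.h + 2 * A) ^ d * W.Λ ^ d * c) (R l α) x := by
    intro l hl' α hα
    have hlen : (multiIndexWord α).length = l := by
      rw [length_multiIndexWord]
      exact (sum_le_of_mem hl' hα).1
    have hld := Finset.mem_range_succ_iff.1 hl'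
    have hcg' : W.Bound κ (T + (multiIndexWord α).length) c g x := hcg.anti (by omega)
    by_cases hl2 : l = d
    · simp only [R, hl2, if_true]
      refine (hcg'.twistWord_sub hΩ hg hx hl hη _ (by omega)).mono ?_
      rw [hlen, hl2, mul_pow]
    · simp only [R, hl2, if_false]
      refine (hcg'.twistWord hΩ hg hx hl hη _ (by omega)).gain.mono ?_
      rw [hlen, mul_pow]
      -- Here `l < d`, so the factor `Λ` paid for the gain still fits into `Λ ^ d`.
      calc W.Λ * ((2 * W.h + 2 * A) ^ l * W.Λ ^ l * c)
          = (2 * W.h + 2 * A) ^ l * W.Λ ^ (l + 1) * c := by ring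
        _ ≤ (2 * W.h + 2 * A) ^ d * W.Λ ^ d * c := by
          have h1 := pow_le_pow_right₀ hC hld
          have h2 := pow_le_pow_right₀ hΛ (show l + 1 ≤ d by omega)
          gcongr
  have hmain := (hcg.anti (by omega : T ≤ T + d)).const_mul hΩ hg hx ((lam : ℂ) ^ d)
  have h1 := hmain.mul_small hΩ hsym (contDiffOn_const.mul hg) hx (by omega) hB hBt
  have hsm2 : ∀ l ∈ Finset.range (d + 1),
      ∀ α ∈ Finset.piAntidiag (Finset.univ : Finset (Fin n)) l,
      ContDiffOn ℝ ∞ (fun y => P.coeff α y * R l α y) Ω := fun l hl' α hα =>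
    (hP α (sum_le_of_mem hl' hα).2).mul (hRsm l α)
  have h2 := Bound.sum (W := W) (κ := κ + 1) (T := T) hΩ
    (s := Finset.range (d + 1))
    (F := fun l y => ∑ α ∈ Finset.piAntidiag (Finset.univ : Finset (Fin n)) l,
      P.coeff α y * R l α y)
    (fun l hl' => ContDiffOn.sum fun α hα => hsm2 l hl' α hα) hx
    (fun l hl' => Bound.sum hΩ (fun α hα => hsm2 l hl' α hα) hx
      (fun α hα => (hR l hl' α hα).mul hΩ (hP α (sum_le_of_mem hl' hα).2) (hRsm l α) hx
        (by omega) (hA α (sum_le_of_mem hl' hα).2)))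
  have h3 := h1.add hΩ (hsym.mul (contDiffOn_const.mul hg))
    (ContDiffOn.sum fun l hl' => ContDiffOn.sum fun α hα => hsm2 l hl' α hα) hx h2
  refine (h3.congr hΩ hx ?_).mono ?_
  · intro y _
    simp only [conj, ← hd]
    rw [Finset.sum_range_succ, Finset.sum_range_succ _ d, ← add_assoc,
      add_comm (P.covectorSymbol x₀ ξ y * _), add_assoc]
    congr 1
    · refine Finset.sum_congr rfl fun l hl' => Finset.sum_congr rfl fun α _ => ?_
      simp only [R, (Finset.mem_range.1 hl').ne, if_false]
    · simp only [covectorSymbol, ← hd]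
      rw [Finset.sum_mul, ← Finset.sum_add_distrib]
      refine Finset.sum_congr rfl fun α hα => ?_
      have hlen : (multiIndexWord α).length = d := by
        rw [length_multiIndexWord]
        exact sum_le_of_mem_order hα
      simp only [R, if_true, hlen]
      ring
  · simp only [conjConst, ← hd]
    rw [add_mul, add_mul]
    refine add_le_add ?_ (le_of_eq ?_)
    · calc 2 * B * (‖(lam : ℂ) ^ d‖ * c) ≤ 2 * B * (W.Λ ^ d * c) := by gcongr
        _ = _ := by ring
    · rw [Finset.sum_mul, Finset.sum_mul]
      refine Finset.sum_congr rfl fun l _ => ?_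
      rw [Finset.sum_mul, Finset.sum_mul]
      exact Finset.sum_congr rfl fun α _ => by ring

theorem bound_one (x : Euc n) (T : ℕ) : W.Bound 0 T 1 (fun _ => 1) x := by
  intro w _
  have h1 := W.hY_nonneg
  rcases eq_or_ne w [] with rfl | hw
  · simp
  · rw [wordD_const 1 w hw]
    simp only [norm_zero, one_mul, Nat.zero_sub, pow_zero, mul_one]
    positivity

/-- Each application raises the number of gains by one and uses up `P.order` of the `W.N`
derivatives under control. -/
theorem bound_iterate_conj (hΩ : IsOpen Ω) (hP : P.HasSmoothCoeffs Ω)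
    (hx : x ∈ Ω) (hl : |lam| ≤ W.Λ)
    (hη : ∀ i, GevreyBoundAt W.r A W.h (complexCovector x₀ ξ i) x)
    (hA : ∀ α : Fin n → ℕ, ∑ i, α i ≤ P.order → GevreyBoundAt W.r A W.h (P.coeff α) x)
    (hB : GevreyBoundAt W.r B W.h (P.covectorSymbol x₀ ξ) x)
    (hBt : ‖P.covectorSymbol x₀ ξ x‖ ≤ B * W.t) (k : ℕ) (hk : P.order * k ≤ W.N) :
    W.Bound k (W.N - P.order * k) ((P.conjConst W.h A B * W.Λ ^ P.order) ^ k)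
      ((P.conj x₀ ξ lam)^[k] fun _ => 1) x := by
  induction k with
  | zero => simpa using bound_one x W.N
  | succ k ih =>
    rw [mul_add, mul_one] at hk ⊢
    have h := (ih (by omega)).anti (by omega : W.N - (P.order * k + P.order) + P.order ≤ _)
    rw [Function.iterate_succ_apply', pow_succ']
    exact bound_conj hΩ hP (iterate_conj_contDiffOn hΩ hP contDiffOn_const k) hx hl hη hA hB hBt
      (by omega) h

theorem norm_iterate_conj_le (hΩ : IsOpen Ω) (hP : P.HasSmoothCoeffs Ω)
    (hx : x ∈ Ω) (hl : |lam| ≤ W.Λ)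
    (hη : ∀ i, GevreyBoundAt W.r A W.h (complexCovector x₀ ξ i) x)
    (hA : ∀ α : Fin n → ℕ, ∑ i, α i ≤ P.order → GevreyBoundAt W.r A W.h (P.coeff α) x)
    (hB : GevreyBoundAt W.r B W.h (P.covectorSymbol x₀ ξ) x)
    (hBt : ‖P.covectorSymbol x₀ ξ x‖ ≤ B * W.t) (k : ℕ) (hk : P.order * k ≤ W.N) :
    ‖(P.conj x₀ ξ lam)^[k] (fun _ => 1) x‖
      ≤ (P.conjConst W.h A B * W.Λ ^ P.order) ^ k * W.t ^ k := by
  simpa using bound_iterate_conj hΩ hP hx hl hη hA hB hBt k hk [] (Nat.zero_le _)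

end Bounds

end LinDiffOp

/-! ### Elementary inequalities -/

theorem rpow_mul_exp_neg_half_le {a x : ℝ} (ha : 0 < a) (hx : 0 ≤ x) :
    x ^ a * Real.exp (-(x / 2)) ≤ (2 * a) ^ a := by
  have h1 : x / (2 * a) ≤ Real.exp (x / (2 * a)) := by
    have := Real.add_one_le_exp (x / (2 * a))
    linarith
  have h2 : x ≤ 2 * a * Real.exp (x / (2 * a)) := by
    rw [div_le_iff₀ (by positivity)] at h1
    linarith
  calc x ^ a * Real.exp (-(x / 2))
      ≤ (2 * a * Real.exp (x / (2 * a))) ^ a * Real.exp (-(x / 2)) := by gcongr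
    _ = (2 * a) ^ a := by
        rw [Real.mul_rpow (by positivity) (by positivity), ← Real.exp_mul, mul_assoc,
          ← Real.exp_add]
        have : x / (2 * a) * a + -(x / 2) = 0 := by field_simp; ring
        rw [this, Real.exp_zero, mul_one]

/-- After a `k`-th root and squaring this is `y ≤ exp y` at `y = lam ρ²/k`. It converts vanishing at
the centre into a negative power of the frequency. -/
theorem pow_mul_exp_neg_sq_le {k : ℕ} {lam Y ρ : ℝ} (hk : k ≠ 0) (hlam : 0 < lam)
    (hkY : (k : ℝ) ≤ Y) (hρ : 0 ≤ ρ) :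
    ρ ^ k * Real.exp (-(lam * ρ ^ 2 / 2)) ≤ √(Y / lam) ^ k := by
  have hk0 : (0 : ℝ) < k := by exact_mod_cast Nat.pos_of_ne_zero hk
  have h1 : ρ * Real.exp (-(lam * ρ ^ 2 / (2 * k))) ≤ √(Y / lam) := by
    apply Real.le_sqrt_of_sq_le
    rw [mul_pow, ← Real.exp_nat_mul]
    have h2 : lam * ρ ^ 2 / k ≤ Real.exp (lam * ρ ^ 2 / k) := by
      have := Real.add_one_le_exp (lam * ρ ^ 2 / k)
      linarith
    have h3 : ((2 : ℕ) : ℝ) * -(lam * ρ ^ 2 / (2 * k)) = -(lam * ρ ^ 2 / k) := by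
      push_cast
      field_simp
    rw [h3, Real.exp_neg, ← div_eq_mul_inv, div_le_div_iff₀ (Real.exp_pos _) hlam]
    rw [div_le_iff₀ hk0] at h2
    calc ρ ^ 2 * lam = lam * ρ ^ 2 := by ring
      _ ≤ Real.exp (lam * ρ ^ 2 / k) * k := h2
      _ ≤ Real.exp (lam * ρ ^ 2 / k) * Y := by gcongr
      _ = _ := by ring
  calc ρ ^ k * Real.exp (-(lam * ρ ^ 2 / 2))
      = (ρ * Real.exp (-(lam * ρ ^ 2 / (2 * k)))) ^ k := by
        rw [mul_pow, ← Real.exp_nat_mul]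
        congr 2
        field_simp
    _ ≤ √(Y / lam) ^ k := by gcongr

theorem rpow_self_mul_le {N : ℕ} {s : ℝ} (hs : 0 ≤ s) :
    (N : ℝ) ^ (s * N) ≤ Real.exp s ^ N * ((N.factorial : ℕ) : ℝ) ^ s := by
  have h1 : (N : ℝ) ^ N ≤ Real.exp N * (N.factorial : ℝ) := by
    have := Real.pow_div_factorial_le_exp (N : ℝ) (by positivity) N
    rwa [div_le_iff₀ (by positivity)] at this
  calc (N : ℝ) ^ (s * N) = ((N : ℝ) ^ N) ^ s := by
        rw [mul_comm, Real.rpow_mul (by positivity), Real.rpow_natCast]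
    _ ≤ (Real.exp N * (N.factorial : ℝ)) ^ s := by gcongr
    _ = Real.exp s ^ N * ((N.factorial : ℕ) : ℝ) ^ s := by
        rw [Real.mul_rpow (by positivity) (by positivity), ← Real.exp_mul, ← Real.exp_nat_mul]

/-- The estimate of the terms of the series that defines the Gevrey vector. -/
theorem packet_term_le {r s σ : ℝ} {d : ℕ} (hr : 1 ≤ r) (hrs : r < s) (hsσ : s < σ)
    (hσ : d ≠ 0 → σ * (d - 1 / 2) + r / 2 ≤ s * d) (k j : ℕ) {ρ lam Y Λ : ℝ}
    (hρ0 : 0 ≤ ρ) (hρ1 : ρ ≤ 1) (hlam : lam = (j : ℝ) ^ σ)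
    (hY : Y = ((max 1 (d * k) : ℕ) : ℝ) ^ r) (hΛ : Λ = max lam Y) :
    Real.exp (-j) * (Real.exp (-(lam * ρ ^ 2 / 2)) * ((Λ ^ d) ^ k * max ρ √(Y / Λ) ^ k))
      ≤ Real.exp (-(j / 2)) *
        (2 * ((2 * σ) ^ (σ * d) * Real.exp (s * d)) ^ k * (((d * k).factorial : ℕ) : ℝ) ^ s) := by
  have hσ1 : 1 < σ := by linarith
  have hlam0 : 0 ≤ lam := by rw [hlam]; positivity
  have hY1 : 1 ≤ Y := by
    rw [hY]
    exact Real.one_le_rpow (by exact_mod_cast le_max_left _ _) (by linarith)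
  have hΛ1 : 1 ≤ Λ := by rw [hΛ]; exact hY1.trans (le_max_right _ _)
  have hΛ0 : 0 < Λ := by linarith
  have ht1 : max ρ √(Y / Λ) ≤ 1 := by
    refine max_le hρ1 (Real.sqrt_le_one.2 ?_)
    rw [div_le_one hΛ0, hΛ]
    exact le_max_right _ _
  have ht0 : 0 ≤ max ρ √(Y / Λ) := hρ0.trans (le_max_left _ _)
  have hexp1 : Real.exp (-(lam * ρ ^ 2 / 2)) ≤ 1 := by
    rw [Real.exp_le_one_iff]
    have : 0 ≤ lam * ρ ^ 2 / 2 := by positivity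
    linarith
  have hj : Real.exp (-(j : ℝ)) ≤ Real.exp (-(j / 2)) := by
    apply Real.exp_le_exp.2
    have : (0 : ℝ) ≤ j := by positivity
    linarith
  have hC1 : 1 ≤ (2 * σ) ^ (σ * (d : ℝ)) := Real.one_le_rpow (by linarith) (by positivity)
  have hfac := one_le_factorial_rpow (r := s) (by linarith) (d * k)
  have hCe : (1 : ℝ) ≤ Real.exp (s * d) := by
    rw [Real.one_le_exp_iff]
    have : 0 ≤ s := by linarith
    positivity
  have hC : 1 ≤ (2 * σ) ^ (σ * (d : ℝ)) * Real.exp (s * d) :=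
    one_le_mul_of_one_le_of_one_le hC1 hCe
  have htk : max ρ √(Y / Λ) ^ k ≤ 1 := pow_le_one₀ ht0 ht1
  have hsimple : (Λ ^ d) ^ k ≤ ((2 * σ) ^ (σ * d) * Real.exp (s * d)) ^ k *
      (((d * k).factorial : ℕ) : ℝ) ^ s →
      Real.exp (-j) * (Real.exp (-(lam * ρ ^ 2 / 2)) * ((Λ ^ d) ^ k * max ρ √(Y / Λ) ^ k))
      ≤ Real.exp (-(j / 2)) *
        (2 * ((2 * σ) ^ (σ * d) * Real.exp (s * d)) ^ k *
          (((d * k).factorial : ℕ) : ℝ) ^ s) := by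
    intro h
    refine mul_le_mul hj ?_ (by positivity) (by positivity)
    calc Real.exp (-(lam * ρ ^ 2 / 2)) * ((Λ ^ d) ^ k * max ρ √(Y / Λ) ^ k)
        ≤ 1 * ((Λ ^ d) ^ k * 1) := by gcongr
      _ = (Λ ^ d) ^ k := by ring
      _ ≤ _ := h
      _ ≤ 2 * (((2 * σ) ^ (σ * d) * Real.exp (s * d)) ^ k *
          (((d * k).factorial : ℕ) : ℝ) ^ s) := by
        have : 0 ≤ ((2 * σ) ^ (σ * d) * Real.exp (s * d)) ^ k *
          (((d * k).factorial : ℕ) : ℝ) ^ s := by positivity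
        linarith
      _ = _ := by ring
  -- For `d = 0` or `k = 0` no power of `Λ` occurs, so order zero imposes no condition on `σ`.
  rcases Nat.eq_zero_or_pos (d * k) with hN0 | hN0
  · apply hsimple
    rw [← pow_mul, hN0, pow_zero]
    rw [hN0] at hfac
    exact one_le_mul_of_one_le_of_one_le (one_le_pow₀ hC) hfac
  have hd0 : d ≠ 0 := by rintro rfl; simp at hN0
  have hk0 : k ≠ 0 := by rintro rfl; simp at hN0
  have hN1 : (1 : ℝ) ≤ ((d * k : ℕ) : ℝ) := by exact_mod_cast hN0
  have hNpos : (0 : ℝ) < ((d * k : ℕ) : ℝ) := by linarith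
  have hYN : Y = ((d * k : ℕ) : ℝ) ^ r := by rw [hY, max_eq_right hN0]
  have hexpk : Real.exp s ^ (d * k) = Real.exp (s * d) ^ k := by
    rw [← Real.exp_nat_mul, ← Real.exp_nat_mul]
    push_cast
    ring_nf
  have hself := rpow_self_mul_le (N := d * k) (s := s) (by linarith)
  rw [hexpk] at hself
  -- At low frequency `Λ = Y` and no gain is needed: `Y ^ (d * k)` is `(dk)^(r d k)`, and `r < s`.
  rcases le_or_gt lam Y with hlY | hlY
  · apply hsimple
    have hΛY : Λ = Y := by rw [hΛ, max_eq_right hlY]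
    rw [hΛY, ← pow_mul, hYN, ← Real.rpow_natCast, ← Real.rpow_mul hNpos.le]
    calc ((d * k : ℕ) : ℝ) ^ (r * ((d * k : ℕ) : ℝ))
        ≤ ((d * k : ℕ) : ℝ) ^ (s * ((d * k : ℕ) : ℝ)) :=
          Real.rpow_le_rpow_of_exponent_le hN1 (by gcongr)
      _ ≤ _ := hself
      _ ≤ _ := by
        rw [mul_pow]
        gcongr
        exact le_mul_of_one_le_left (by positivity) (one_le_pow₀ hC1)
  · have hΛl : Λ = lam := by rw [hΛ, max_eq_left hlY.le]
    rw [hΛl]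
    have hlpos : 0 < lam := by linarith
    have hjpos : (0 : ℝ) < j := by
      rcases Nat.eq_zero_or_pos j with rfl | h
      · rw [hlam, Nat.cast_zero, Real.zero_rpow (by linarith)] at hlpos
        exact absurd hlpos (lt_irrefl _)
      · exact_mod_cast h
    have hkY : (k : ℝ) ≤ Y := by
      calc (k : ℝ) ≤ ((d * k : ℕ) : ℝ) := by
            exact_mod_cast Nat.le_mul_of_pos_left k (Nat.pos_of_ne_zero hd0)
        _ ≤ Y := by
          rw [hYN]
          exact Real.self_le_rpow_of_one_le hN1 hr
    have hgauss := pow_mul_exp_neg_sq_le hk0 hlpos hkY hρ0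
    set τ := √(Y / lam) with hτ
    have hτ0 : 0 ≤ τ := Real.sqrt_nonneg _
    -- Against the Gaussian, the distance `ρ` to the centre is no worse than `τ`.
    have hmax : Real.exp (-(lam * ρ ^ 2 / 2)) * max ρ τ ^ k ≤ 2 * τ ^ k := by
      have h1 : max ρ τ ^ k ≤ ρ ^ k + τ ^ k := by
        rcases max_cases ρ τ with ⟨h, _⟩ | ⟨h, _⟩ <;> rw [h]
        · exact le_add_of_nonneg_right (by positivity)
        · exact le_add_of_nonneg_left (by positivity)
      calc Real.exp (-(lam * ρ ^ 2 / 2)) * max ρ τ ^ k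
          ≤ Real.exp (-(lam * ρ ^ 2 / 2)) * (ρ ^ k + τ ^ k) := by gcongr
        _ = ρ ^ k * Real.exp (-(lam * ρ ^ 2 / 2)) + Real.exp (-(lam * ρ ^ 2 / 2)) * τ ^ k := by
            ring
        _ ≤ τ ^ k + 1 * τ ^ k := by gcongr
        _ = 2 * τ ^ k := by ring
    -- The power of `j` left in `lam ^ (d k) * τ ^ k`: the factor `τ ^ k` removes half a power of
    -- `lam` per application.
    set a : ℝ := σ * (d - 1 / 2) * k with ha
    have hd1 : (1 : ℝ) ≤ d := by exact_mod_cast Nat.one_le_iff_ne_zero.2 hd0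
    have hkpos : (0 : ℝ) < k := by exact_mod_cast Nat.pos_of_ne_zero hk0
    have hapos : 0 < a := by
      have : (0 : ℝ) < (d : ℝ) - 1 / 2 := by linarith
      positivity
    have haN : a ≤ σ * ((d * k : ℕ) : ℝ) := by
      rw [ha]
      push_cast
      have : 0 ≤ σ * (k : ℝ) := by positivity
      nlinarith
    have hpow : (lam ^ d) ^ k * τ ^ k
        = (j : ℝ) ^ a * ((d * k : ℕ) : ℝ) ^ (r * k / 2) := by
      have e1 : τ ^ k = Y ^ ((k : ℝ) / 2) * (lam ^ ((k : ℝ) / 2))⁻¹ := by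
        rw [hτ, Real.sqrt_eq_rpow, ← Real.rpow_natCast, ← Real.rpow_mul (by positivity),
          Real.div_rpow (by linarith) hlam0, div_eq_mul_inv]
        ring_nf
      have e2 : (lam ^ d) ^ k = lam ^ (((d * k : ℕ) : ℝ)) := by
        rw [← pow_mul, Real.rpow_natCast]
      have e3 : lam ^ (((d * k : ℕ) : ℝ)) * (lam ^ ((k : ℝ) / 2))⁻¹ = (j : ℝ) ^ a := by
        rw [← Real.rpow_neg hlam0, ← Real.rpow_add hlpos, hlam, ← Real.rpow_mul hjpos.le, ha]
        congr 1
        push_cast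
        ring
      have e4 : Y ^ ((k : ℝ) / 2) = ((d * k : ℕ) : ℝ) ^ (r * k / 2) := by
        rw [hYN, ← Real.rpow_mul hNpos.le]
        ring_nf
      rw [e1, e2, ← e3, ← e4]
      ring
    have hbase : (j : ℝ) ^ a * Real.exp (-(j / 2))
        ≤ ((2 * σ) ^ (σ * (d : ℝ))) ^ k * ((d * k : ℕ) : ℝ) ^ a := by
      calc (j : ℝ) ^ a * Real.exp (-(j / 2)) ≤ (2 * a) ^ a :=
            rpow_mul_exp_neg_half_le hapos hjpos.le
        _ ≤ (2 * σ * ((d * k : ℕ) : ℝ)) ^ a :=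
            Real.rpow_le_rpow (by positivity) (by linarith) hapos.le
        _ = (2 * σ) ^ a * ((d * k : ℕ) : ℝ) ^ a := Real.mul_rpow (by linarith) hNpos.le
        _ ≤ (2 * σ) ^ (σ * ((d * k : ℕ) : ℝ)) * ((d * k : ℕ) : ℝ) ^ a := by
            gcongr
            linarith
        _ = _ := by
            rw [← Real.rpow_mul_natCast (by linarith)]
            push_cast
            ring_nf
    have hcomb : ((d * k : ℕ) : ℝ) ^ a * ((d * k : ℕ) : ℝ) ^ (r * k / 2)
        ≤ Real.exp (s * d) ^ k * (((d * k).factorial : ℕ) : ℝ) ^ s := by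
      rw [← Real.rpow_add hNpos]
      refine le_trans (Real.rpow_le_rpow_of_exponent_le hN1 ?_) hself
      calc a + r * k / 2 = (σ * (d - 1 / 2) + r / 2) * k := by rw [ha]; ring
        _ ≤ (s * d) * k := by
            gcongr
            exact hσ hd0
        _ = s * ((d * k : ℕ) : ℝ) := by push_cast; ring
    -- One half absorbs `j ^ a`, the other keeps the sum over `j` convergent.
    have hjj : Real.exp (-(j : ℝ)) = Real.exp (-(j / 2)) * Real.exp (-((j : ℝ) / 2)) := by
      rw [← Real.exp_add]
      ring_nf
    calc Real.exp (-j) * (Real.exp (-(lam * ρ ^ 2 / 2)) * ((lam ^ d) ^ k * max ρ τ ^ k))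
        = Real.exp (-j) * (lam ^ d) ^ k * (Real.exp (-(lam * ρ ^ 2 / 2)) * max ρ τ ^ k) := by
          ring
      _ ≤ Real.exp (-j) * (lam ^ d) ^ k * (2 * τ ^ k) := by gcongr
      _ = 2 * Real.exp (-j) * ((lam ^ d) ^ k * τ ^ k) := by ring
      _ = Real.exp (-(j / 2)) * (2 * ((j : ℝ) ^ a * Real.exp (-(j / 2))) *
            ((d * k : ℕ) : ℝ) ^ (r * k / 2)) := by
          rw [hpow, hjj]
          ring
      _ ≤ Real.exp (-(j / 2)) * (2 * (((2 * σ) ^ (σ * (d : ℝ))) ^ k * ((d * k : ℕ) : ℝ) ^ a) *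
            ((d * k : ℕ) : ℝ) ^ (r * k / 2)) := by gcongr
      _ = Real.exp (-(j / 2)) * (2 * ((2 * σ) ^ (σ * (d : ℝ))) ^ k *
            (((d * k : ℕ) : ℝ) ^ a * ((d * k : ℕ) : ℝ) ^ (r * k / 2))) := by ring
      _ ≤ Real.exp (-(j / 2)) * (2 * ((2 * σ) ^ (σ * (d : ℝ))) ^ k *
            (Real.exp (s * d) ^ k * (((d * k).factorial : ℕ) : ℝ) ^ s)) := by gcongr
      _ = _ := by
          rw [mul_pow]
          ring

/-! ### Series of smooth functions -/

section Series

variable {n : ℕ} {Ω : Set (Euc n)} {f : Euc n → ℂ} {x : Euc n}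

theorem fderiv_apply_eq_sum (f : Euc n → ℂ) (x v : Euc n) :
    fderiv ℝ f x v = ∑ j, (v j : ℂ) * (Complex.I * partialD j f x) := by
  have hv : v = ∑ j, v j • EuclideanSpace.single j (1 : ℝ) := by
    have := (EuclideanSpace.basisFun (Fin n) ℝ).sum_repr v
    simpa using this.symm
  conv_lhs => rw [hv]
  rw [map_sum]
  refine Finset.sum_congr rfl fun j _ => ?_
  rw [map_smul, partialD, ← mul_assoc Complex.I]
  simp

theorem norm_fderiv_le_sum (f : Euc n → ℂ) (x : Euc n) :
    ‖fderiv ℝ f x‖ ≤ ∑ j, ‖partialD j f x‖ := by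
  refine ContinuousLinearMap.opNorm_le_bound _ (Finset.sum_nonneg fun _ _ => norm_nonneg _) ?_
  intro v
  rw [fderiv_apply_eq_sum, Finset.sum_mul]
  refine (norm_sum_le _ _).trans (Finset.sum_le_sum fun j _ => ?_)
  rw [norm_mul, norm_mul, Complex.norm_I, one_mul, mul_comm, Complex.norm_real]
  gcongr
  exact PiLp.norm_apply_le v j

/-- Any directional derivative is a combination of the `D_j`, so differentiability of every word
bootstraps to smoothness. -/
theorem contDiff_of_differentiable_wordD
    (h : ∀ w : List (Fin n), Differentiable ℝ (wordD w f)) : ContDiff ℝ ∞ f := by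
  rw [contDiff_infty]
  intro m
  suffices ∀ w : List (Fin n), ContDiff ℝ m (wordD w f) from this []
  induction m with
  | zero => exact fun w => contDiff_zero.2 (h w).continuous
  | succ m ih =>
    intro w
    push_cast
    rw [contDiff_succ_iff_fderiv_apply]
    refine ⟨h w, by simp, fun v => ?_⟩
    have : (fun x => fderiv ℝ (wordD w f) x v)
        = fun x => ∑ j, (v j : ℂ) * (Complex.I * wordD (j :: w) f x) := by
      funext x
      rw [fderiv_apply_eq_sum]
      rfl
    rw [this]
    exact ContDiff.sum fun j _ => contDiff_const.mul (contDiff_const.mul (ih _))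

/-- All derivatives of the functions `F j` are summable, locally uniformly. -/
def LocallySummableDerivs (F : ℕ → Euc n → ℂ) : Prop :=
  ∀ (w : List (Fin n)) (R : ℝ), ∃ v : ℕ → ℝ, Summable v ∧
    ∀ j, ∀ x ∈ Metric.ball (0 : Euc n) R, ‖wordD w (F j) x‖ ≤ v j

theorem LocallySummableDerivs.summable {F : ℕ → Euc n → ℂ} (hF : LocallySummableDerivs F)
    (w : List (Fin n)) (x : Euc n) : Summable fun j => wordD w (F j) x := by
  obtain ⟨v, hv, hb⟩ := hF w (‖x‖ + 1)
  exact Summable.of_norm_bounded hv fun j => hb j x (by simp)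

theorem LocallySummableDerivs.hasFDerivAt {F : ℕ → Euc n → ℂ} (hF : LocallySummableDerivs F)
    (hsm : ∀ j, ContDiff ℝ ∞ (F j)) (w : List (Fin n)) (x : Euc n) :
    HasFDerivAt (fun y => ∑' j, wordD w (F j) y) (∑' j, fderiv ℝ (wordD w (F j)) x) x ∧
      Summable fun j => fderiv ℝ (wordD w (F j)) x := by
  choose v hv hb using fun i => hF (i :: w) (‖x‖ + 1)
  have hsum : Summable fun j => ∑ i, v i j := summable_sum fun i _ => hv i
  have hbound : ∀ j, ∀ y ∈ Metric.ball (0 : Euc n) (‖x‖ + 1),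
      ‖fderiv ℝ (wordD w (F j)) y‖ ≤ ∑ i, v i j := fun j y hy =>
    (norm_fderiv_le_sum _ _).trans (Finset.sum_le_sum fun i _ => hb i j y hy)
  have hx : x ∈ Metric.ball (0 : Euc n) (‖x‖ + 1) := by simp
  refine ⟨?_, Summable.of_norm_bounded hsum fun j => hbound j x hx⟩
  refine hasFDerivAt_tsum_of_isPreconnected (f := fun j y => wordD w (F j) y)
    (f' := fun j y => fderiv ℝ (wordD w (F j)) y) hsum Metric.isOpen_ball
    (convex_ball _ _).isPreconnected (fun j y _ => ?_) hbound hx (hF.summable w x) hx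
  exact (wordD_differentiableAt isOpen_univ (hsm j).contDiffOn w (Set.mem_univ y)).hasFDerivAt

theorem LocallySummableDerivs.wordD_tsum {F : ℕ → Euc n → ℂ} (hF : LocallySummableDerivs F)
    (hsm : ∀ j, ContDiff ℝ ∞ (F j)) (w : List (Fin n)) :
    wordD w (fun y => ∑' j, F j y) = fun y => ∑' j, wordD w (F j) y := by
  induction w with
  | nil => rfl
  | cons i w ih =>
    funext x
    obtain ⟨h1, h2⟩ := hF.hasFDerivAt hsm w x
    rw [wordD_cons, ih, partialD, h1.fderiv]
    have h3 := (ContinuousLinearMap.apply ℝ ℂ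
      (EuclideanSpace.single i (1 : ℝ) : Euc n)).map_tsum h2
    simp only [ContinuousLinearMap.apply_apply] at h3
    rw [h3, ← tsum_mul_left]
    rfl

theorem LocallySummableDerivs.contDiff_tsum {F : ℕ → Euc n → ℂ} (hF : LocallySummableDerivs F)
    (hsm : ∀ j, ContDiff ℝ ∞ (F j)) : ContDiff ℝ ∞ fun y => ∑' j, F j y := by
  refine contDiff_of_differentiable_wordD fun w => ?_
  rw [hF.wordD_tsum hsm]
  exact fun x => (hF.hasFDerivAt hsm w x).1.differentiableAt

/-- The smooth function `f` is the sum in `Ω` of the smooth functions `F j`, together with all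
derivatives. -/
structure HasSmoothSum (Ω : Set (Euc n)) (F : ℕ → Euc n → ℂ) (f : Euc n → ℂ) : Prop where
  contDiffOn : ContDiffOn ℝ ∞ f Ω
  contDiffOn_term : ∀ j, ContDiffOn ℝ ∞ (F j) Ω
  hasSum : ∀ (w : List (Fin n)), ∀ x ∈ Ω, HasSum (fun j => wordD w (F j) x) (wordD w f x)

theorem HasSmoothSum.wordD (hΩ : IsOpen Ω) {F : ℕ → Euc n → ℂ} (h : HasSmoothSum Ω F f)
    (v : List (Fin n)) : HasSmoothSum Ω (fun j => wordD v (F j)) (wordD v f) where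
  contDiffOn := wordD_contDiffOn hΩ h.contDiffOn v
  contDiffOn_term j := wordD_contDiffOn hΩ (h.contDiffOn_term j) v
  hasSum w x hx := by
    simp only [← wordD_append]
    exact h.hasSum _ x hx

/-- By the Leibniz rule, pointwise summability of all derivatives survives multiplication by a
smooth function. Hence `P` and its iterates act termwise with no further uniform convergence
argument. -/
theorem HasSmoothSum.mul_left (hΩ : IsOpen Ω) {F : ℕ → Euc n → ℂ} (h : HasSmoothSum Ω F f)
    {p : Euc n → ℂ} (hp : ContDiffOn ℝ ∞ p Ω) :
    HasSmoothSum Ω (fun j y => p y * F j y) (fun y => p y * f y) where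
  contDiffOn := hp.mul h.contDiffOn
  contDiffOn_term j := hp.mul (h.contDiffOn_term j)
  hasSum w x hx := by
    induction w using List.reverseRecOn generalizing p F f with
    | nil => exact (h.hasSum [] x hx).mul_left (p x)
    | append_singleton w i ih =>
      have hprod : ∀ g : Euc n → ℂ, ContDiffOn ℝ ∞ g Ω →
          _root_.wordD (w ++ [i]) (fun y => p y * g y) x
            = _root_.wordD w (fun y => partialD i p y * g y) x
              + _root_.wordD w (fun y => p y * partialD i g y) x := by
        intro g hg
        have he : Set.EqOn (_root_.wordD [i] fun y => p y * g y)
            (fun y => partialD i p y * g y + p y * partialD i g y) Ω := fun y hy =>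
          partialD_mul_apply (hp.differentiableAt_of_isOpen hΩ hy)
            (hg.differentiableAt_of_isOpen hΩ hy) i
        rw [wordD_append, wordD_congr hΩ he w hx, wordD_add hΩ
          ((partialD_contDiffOn hΩ hp i).mul hg) (hp.mul (partialD_contDiffOn hΩ hg i)) w hx]
      rw [hprod f h.contDiffOn]
      simp only [hprod _ (h.contDiffOn_term _)]
      exact (ih h (partialD_contDiffOn hΩ hp i)).add (ih (h.wordD hΩ [i]) hp)

theorem HasSmoothSum.sum (hΩ : IsOpen Ω) {ι : Type*} {s : Finset ι}
    {F : ι → ℕ → Euc n → ℂ} {f : ι → Euc n → ℂ} (h : ∀ i ∈ s, HasSmoothSum Ω (F i) (f i)) :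
    HasSmoothSum Ω (fun j y => ∑ i ∈ s, F i j y) (fun y => ∑ i ∈ s, f i y) where
  contDiffOn := ContDiffOn.sum fun i hi => (h i hi).contDiffOn
  contDiffOn_term j := ContDiffOn.sum fun i hi => (h i hi).contDiffOn_term j
  hasSum w x hx := by
    rw [wordD_sum hΩ s (fun i hi => (h i hi).contDiffOn) w hx]
    simp only [wordD_sum hΩ s (fun i hi => (h i hi).contDiffOn_term _) w hx]
    exact hasSum_sum fun i hi => (h i hi).hasSum w x hx

theorem HasSmoothSum.apply (hΩ : IsOpen Ω) {P : LinDiffOp n} (hP : P.HasSmoothCoeffs Ω)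
    {F : ℕ → Euc n → ℂ} (h : HasSmoothSum Ω F f) :
    HasSmoothSum Ω (fun j => P.apply (F j)) (P.apply f) := by
  unfold LinDiffOp.apply
  simp only [multiD_eq_wordD]
  refine HasSmoothSum.sum hΩ fun l hl => HasSmoothSum.sum hΩ fun α hα => ?_
  exact (h.wordD hΩ _).mul_left hΩ (hP α (LinDiffOp.sum_le_of_mem hl hα).2)

theorem HasSmoothSum.iterate_apply (hΩ : IsOpen Ω) {P : LinDiffOp n}
    (hP : P.HasSmoothCoeffs Ω) {F : ℕ → Euc n → ℂ} (h : HasSmoothSum Ω F f) (k : ℕ) :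
    HasSmoothSum Ω (fun j => P.apply^[k] (F j)) (P.apply^[k] f) := by
  induction k with
  | zero => exact h
  | succ k ih =>
    simp only [Function.iterate_succ_apply']
    exact ih.apply hΩ hP

theorem LocallySummableDerivs.hasSmoothSum {F : ℕ → Euc n → ℂ} (hF : LocallySummableDerivs F)
    (hsm : ∀ j, ContDiff ℝ ∞ (F j)) : HasSmoothSum Ω F fun y => ∑' j, F j y where
  contDiffOn := (hF.contDiff_tsum hsm).contDiffOn
  contDiffOn_term j := (hsm j).contDiffOn
  hasSum w x _ := by
    rw [hF.wordD_tsum hsm]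
    exact (hF.summable w x).hasSum

end Series

/-! ### The series of wave packets -/

section PacketSeries

variable {n : ℕ} {Ω : Set (Euc n)} {x x₀ ξ : Euc n} {σ : ℝ}

/-- The wave packet of frequency `j ^ σ` with the amplitude `exp (-j)`. -/
noncomputable def packetTerm (x₀ ξ : Euc n) (σ : ℝ) (j : ℕ) (x : Euc n) : ℂ :=
  (Real.exp (-j) : ℂ) * wavePacket x₀ ξ ((j : ℝ) ^ σ) x

theorem contDiff_packetTerm (j : ℕ) : ContDiff ℝ ∞ (packetTerm x₀ ξ σ j) :=
  contDiff_const.mul contDiff_wavePacket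

theorem norm_complexCovector_le (i : Fin n) :
    ‖complexCovector x₀ ξ i x‖ ≤ ‖ξ‖ + (‖x‖ + ‖x₀‖) := by
  unfold complexCovector
  refine (norm_add_le _ _).trans (add_le_add ?_ ?_)
  · rw [Complex.norm_real]
    exact PiLp.norm_apply_le ξ i
  · rw [norm_mul, Complex.norm_I, one_mul]
    refine (norm_sub_le _ _).trans (add_le_add ?_ ?_) <;> rw [Complex.norm_real] <;>
      exact PiLp.norm_apply_le _ i

theorem norm_wavePacket_le_one {lam : ℝ} (hlam : 0 ≤ lam) : ‖wavePacket x₀ ξ lam x‖ ≤ 1 := by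
  rw [norm_wavePacket, Real.exp_le_one_iff]
  have : 0 ≤ lam * ‖x - x₀‖ ^ 2 / 2 := by positivity
  linarith

theorem wordD_wavePacket (w : List (Fin n)) (lam : ℝ) (x : Euc n) :
    wordD w (wavePacket x₀ ξ lam) x
      = wavePacket x₀ ξ lam x * twistWord x₀ ξ lam w (fun _ => 1) x := by
  have := wordD_wavePacket_mul (x₀ := x₀) (ξ := ξ) (lam := lam) (g := fun _ => 1) isOpen_univ
    contDiffOn_const w (Set.mem_univ x)
  simpa using this

/-- A crude polynomial bound in `lam`, obtained from the weighted calculus with `t = 1`, where gains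
play no role; the amplitudes `exp (-j)` then make every derived series converge. -/
theorem norm_wordD_wavePacket_le {lam : ℝ} (hlam : 0 ≤ lam) (w : List (Fin n)) :
    ‖wordD w (wavePacket x₀ ξ lam) x‖
      ≤ ((2 + 2 * (1 + (‖ξ‖ + (‖x‖ + ‖x₀‖)))) *
          max lam (max 1 (w.length : ℝ))) ^ w.length := by
  have h1 : 1 ≤ max 1 (w.length : ℝ) := le_max_left _ _
  let W : DerivWeight :=
    { r := 1, h := 1, Y := max 1 (w.length : ℝ), Λ := max lam (max 1 (w.length : ℝ)), t := 1,
      N := w.length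
      one_le_r := le_rfl
      one_le_h := le_rfl
      one_le_Y := h1
      pow_le_Y := by rw [Real.rpow_one]; exact le_max_right _ _
      t_nonneg := zero_le_one
      t_le_one := le_rfl
      Y_le := by rw [one_pow, one_mul]; exact le_max_right _ _ }
  have hb := (LinDiffOp.bound_one (W := W) x w.length).anti (T' := 0 + w.length) (by omega)
  have hl : |lam| ≤ W.Λ := by
    rw [abs_of_nonneg hlam]
    exact le_max_left _ _
  have := hb.twistWord (x₀ := x₀) (ξ := ξ) isOpen_univ contDiffOn_const (Set.mem_univ x) hl
    (A := 1 + (‖ξ‖ + (‖x‖ + ‖x₀‖)))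
    (fun i => gevreyBoundAt_complexCovector zero_le_one
      (le_add_of_nonneg_right (by positivity)) le_rfl i
      ((norm_complexCovector_le i).trans (le_add_of_nonneg_left zero_le_one))) w
    (by rw [zero_add]) [] le_rfl
  rw [wordD_wavePacket, norm_mul]
  refine (mul_le_of_le_one_left (norm_nonneg _) (norm_wavePacket_le_one hlam)).trans ?_
  simpa [W] using this

theorem summable_succ_pow_mul_exp_neg (p : ℕ) :
    Summable fun j : ℕ => ((j : ℝ) + 1) ^ p * Real.exp (-j) := by
  have h := ((summable_nat_add_iff 1).2
    (Real.summable_pow_mul_exp_neg_nat_mul p one_pos)).mul_left (Real.exp 1)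
  refine h.congr fun j => ?_
  push_cast
  rw [mul_left_comm, ← Real.exp_add]
  ring_nf

theorem locallySummableDerivs_packetTerm (hσ : 0 < σ) :
    LocallySummableDerivs (packetTerm x₀ ξ σ) := by
  intro w R
  set Y : ℝ := max 1 (w.length : ℝ) with hY
  set C : ℝ := 2 + 2 * (1 + (‖ξ‖ + (R + ‖x₀‖))) with hC
  refine ⟨fun j => (C * Y) ^ w.length *
    (((j : ℝ) + 1) ^ (⌈σ⌉₊ * w.length) * Real.exp (-j)),
    (summable_succ_pow_mul_exp_neg _).mul_left _, fun j x hx => ?_⟩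
  have hxR : ‖x‖ ≤ R := by simpa using (mem_ball_zero_iff.1 hx).le
  have hR0 : 0 ≤ R := (norm_nonneg x).trans hxR
  have hY1 : 1 ≤ Y := le_max_left _ _
  have hlam : 0 ≤ (j : ℝ) ^ σ := by positivity
  have hj1 : (1 : ℝ) ≤ (j : ℝ) + 1 := by linarith [(Nat.cast_nonneg j : (0 : ℝ) ≤ j)]
  have hmax : max ((j : ℝ) ^ σ) Y ≤ Y * ((j : ℝ) + 1) ^ ⌈σ⌉₊ := by
    apply max_le
    · calc (j : ℝ) ^ σ ≤ ((j : ℝ) + 1) ^ σ := by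
            gcongr
            linarith
        _ ≤ ((j : ℝ) + 1) ^ ((⌈σ⌉₊ : ℕ) : ℝ) :=
            Real.rpow_le_rpow_of_exponent_le hj1 (Nat.le_ceil σ)
        _ = ((j : ℝ) + 1) ^ ⌈σ⌉₊ := Real.rpow_natCast _ _
        _ ≤ _ := le_mul_of_one_le_left (by positivity) hY1
    · exact le_mul_of_one_le_right (by linarith) (one_le_pow₀ hj1)
  unfold packetTerm
  rw [wordD_const_mul isOpen_univ contDiff_wavePacket.contDiffOn _ w (Set.mem_univ x), norm_mul,
    Complex.norm_real, Real.norm_of_nonneg (Real.exp_pos _).le]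
  calc Real.exp (-j) * ‖wordD w (wavePacket x₀ ξ ((j : ℝ) ^ σ)) x‖
      ≤ Real.exp (-j) * ((2 + 2 * (1 + (‖ξ‖ + (‖x‖ + ‖x₀‖)))) *
          max ((j : ℝ) ^ σ) Y) ^ w.length := by
        gcongr
        exact norm_wordD_wavePacket_le hlam w
    _ ≤ Real.exp (-j) * (C * (Y * ((j : ℝ) + 1) ^ ⌈σ⌉₊)) ^ w.length := by
        rw [hC]
        gcongr
    _ = _ := by
        simp only [pow_mul, mul_pow]
        ring

theorem hasSmoothSum_packetTerm (hσ : 0 < σ) :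
    HasSmoothSum Ω (packetTerm x₀ ξ σ) fun y => ∑' j, packetTerm x₀ ξ σ j y :=
  (locallySummableDerivs_packetTerm hσ).hasSmoothSum contDiff_packetTerm

end PacketSeries

/-! ### The sum of the wave packets is not a Gevrey function -/

/-- The polynomials with `D_i ^ m` of a wave packet equal to the wave packet times the `m`-th
polynomial in the `i`-th component of the complex covector. -/
noncomputable def packetPoly (lam : ℝ) : ℕ → Polynomial ℝ
  | 0 => 1
  | m + 1 => Polynomial.derivative (packetPoly lam m)
      + Polynomial.C lam * (Polynomial.X * packetPoly lam m)

theorem packetPoly_coeff_nonneg {lam : ℝ} (hlam : 0 ≤ lam) (m l : ℕ) :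
    0 ≤ (packetPoly lam m).coeff l := by
  induction m generalizing l with
  | zero =>
    rw [packetPoly, Polynomial.coeff_one]
    split_ifs <;> simp
  | succ m ih =>
    rw [packetPoly, Polynomial.coeff_add, Polynomial.coeff_derivative, Polynomial.coeff_C_mul]
    refine add_nonneg (mul_nonneg (ih _) (by positivity)) (mul_nonneg hlam ?_)
    cases l with
    | zero => simp
    | succ l =>
      rw [Polynomial.coeff_X_mul]
      exact ih l

/-- The leading term is `lam ^ m X ^ m`, and with nonnegative coefficients the corrections from
differentiating the covector can only help at `1`. -/
theorem pow_le_eval_packetPoly {lam : ℝ} (hlam : 0 ≤ lam) (m : ℕ) :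
    lam ^ m ≤ (packetPoly lam m).eval 1 := by
  induction m with
  | zero => simp [packetPoly]
  | succ m ih =>
    have hder : 0 ≤ (Polynomial.derivative (packetPoly lam m)).eval 1 := by
      rw [Polynomial.eval_eq_sum_range]
      refine Finset.sum_nonneg fun l _ => ?_
      rw [Polynomial.coeff_derivative, one_pow, mul_one]
      exact mul_nonneg (packetPoly_coeff_nonneg hlam m _) (by positivity)
    rw [packetPoly, Polynomial.eval_add, Polynomial.eval_mul, Polynomial.eval_C,
      Polynomial.eval_mul, Polynomial.eval_X, one_mul, pow_succ']
    exact (mul_le_mul_of_nonneg_left ih hlam).trans (le_add_of_nonneg_left hder)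

section LowerBound

variable {n : ℕ} {Ω : Set (Euc n)} {x₀ ξ : Euc n}

theorem partialD_aeval_complexCovector (q : Polynomial ℝ) (i : Fin n) (x : Euc n) :
    partialD i (fun y => Polynomial.aeval (complexCovector x₀ ξ i y) q) x
      = Polynomial.aeval (complexCovector x₀ ξ i x) (Polynomial.derivative q) := by
  have hη : HasFDerivAt (complexCovector x₀ ξ i) _ x :=
    ((contDiff_complexCovector i).differentiable (by simp) x).hasFDerivAt
  have hq := (q.hasDerivAt_aeval (complexCovector x₀ ξ i x)).hasFDerivAt.restrictScalars ℝ
  have h1 := congrFun (partialD_complexCovector (x₀ := x₀) (ξ := ξ) i i) x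
  simp only [if_true, partialD] at h1
  have h := hq.comp x hη
  have h2 : fderiv ℝ (fun y => Polynomial.aeval (complexCovector x₀ ξ i y) q) x = _ := h.fderiv
  rw [partialD, h2]
  simp only [ContinuousLinearMap.comp_apply, ContinuousLinearMap.coe_restrictScalars',
    ContinuousLinearMap.toSpanSingleton_apply, smul_eq_mul]
  rw [← mul_assoc, h1, one_mul]

theorem twistWord_replicate (lam : ℝ) (i : Fin n) (m : ℕ) :
    twistWord x₀ ξ lam (List.replicate m i) (fun _ => 1)
      = fun x => Polynomial.aeval (complexCovector x₀ ξ i x) (packetPoly lam m) := by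
  induction m with
  | zero =>
    funext x
    simp [packetPoly]
  | succ m ih =>
    funext x
    rw [List.replicate_succ, twistWord_cons, ih, twistD, partialD_aeval_complexCovector,
      packetPoly, map_add, map_mul, map_mul, Polynomial.aeval_X, Polynomial.aeval_C,
      Complex.coe_algebraMap]
    ring

theorem wordD_replicate_wavePacket_self {i : Fin n} (hξ : ξ i = 1) (lam : ℝ) (m : ℕ) :
    wordD (List.replicate m i) (wavePacket x₀ ξ lam) x₀ = ((packetPoly lam m).eval 1 : ℝ) := by
  rw [wordD_wavePacket, twistWord_replicate]
  have h1 : wavePacket x₀ ξ lam x₀ = 1 := by simp [wavePacket, gaussianPhase]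
  have h2 : complexCovector x₀ ξ i x₀ = algebraMap ℝ ℂ 1 := by simp [complexCovector, hξ]
  simp only [h1, one_mul, h2]
  rw [Polynomial.aeval_algebraMap_apply, Complex.coe_algebraMap,
    Polynomial.coe_aeval_eq_eval]

/-- At the centre all terms of the derived series are nonnegative reals, so the single term `j = m`
is a lower bound. -/
theorem le_norm_wordD_packet_series {σ : ℝ} (hσ : 0 < σ) {i : Fin n} (hξ : ξ i = 1) (m : ℕ) :
    Real.exp (-m) * ((m : ℝ) ^ σ) ^ m
      ≤ ‖wordD (List.replicate m i) (fun y => ∑' j, packetTerm x₀ ξ σ j y) x₀‖ := by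
  have hs := (hasSmoothSum_packetTerm (Ω := Set.univ) (x₀ := x₀) (ξ := ξ) hσ).hasSum
    (List.replicate m i) x₀ (Set.mem_univ _)
  have hterm : ∀ j : ℕ, wordD (List.replicate m i) (packetTerm x₀ ξ σ j) x₀
      = ((Real.exp (-j) * (packetPoly ((j : ℝ) ^ σ) m).eval 1 : ℝ) : ℂ) := by
    intro j
    unfold packetTerm
    rw [wordD_const_mul isOpen_univ contDiff_wavePacket.contDiffOn _ _ (Set.mem_univ x₀)]
    simp only [wordD_replicate_wavePacket_self hξ, Complex.ofReal_mul]
  simp only [hterm] at hs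
  have hre := Complex.hasSum_re hs
  simp only [Complex.ofReal_re] at hre
  have hpos : ∀ j : ℕ, ((j : ℝ) ^ σ) ^ m ≤ (packetPoly ((j : ℝ) ^ σ) m).eval 1 :=
    fun j => pow_le_eval_packetPoly (by positivity) m
  calc Real.exp (-m) * ((m : ℝ) ^ σ) ^ m
      ≤ Real.exp (-m) * (packetPoly ((m : ℝ) ^ σ) m).eval 1 := by
        gcongr
        exact hpos m
    _ ≤ (wordD (List.replicate m i) (fun y => ∑' j, packetTerm x₀ ξ σ j y) x₀).re :=
        le_hasSum hre m fun j _ => mul_nonneg (Real.exp_pos _).le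
          (le_trans (by positivity) (hpos j))
    _ ≤ _ := Complex.re_le_norm _

theorem exists_lt_exp_neg_mul_pow {s σ C h : ℝ} (hs : 0 ≤ s) (hsσ : s < σ) (hh : 0 < h) :
    ∃ m : ℕ, C * h ^ m * (((m.factorial : ℕ) : ℝ)) ^ s < Real.exp (-m) * ((m : ℝ) ^ σ) ^ m := by
  have ht : Filter.Tendsto (fun m : ℕ => (m : ℝ) ^ (σ - s)) Filter.atTop Filter.atTop :=
    (tendsto_rpow_atTop (sub_pos.2 hsσ)).comp tendsto_natCast_atTop_atTop
  -- The three factors in `2 e h` absorb `C` (as `C < 2 ^ m`), `exp (-m)` and `h ^ m`.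
  obtain ⟨m, hm1, hm2, hm3⟩ := ((ht.eventually_ge_atTop (2 * Real.exp 1 * h)).and
    ((Filter.eventually_ge_atTop 1).and
      (tendsto_natCast_atTop_atTop.eventually_ge_atTop C))).exists
  refine ⟨m, ?_⟩
  have hm0 : (0 : ℝ) < m := by exact_mod_cast hm2
  have hCm : C < 2 ^ m := lt_of_le_of_lt hm3 (by exact_mod_cast Nat.lt_two_pow_self)
  have hfac : (((m.factorial : ℕ) : ℝ)) ^ s ≤ ((m : ℝ) ^ s) ^ m := by
    calc (((m.factorial : ℕ) : ℝ)) ^ s ≤ ((m : ℝ) ^ m) ^ s := by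
          gcongr
          exact_mod_cast Nat.factorial_le_pow m
      _ = ((m : ℝ) ^ s) ^ m := by
          rw [← Real.rpow_natCast, ← Real.rpow_natCast, ← Real.rpow_mul hm0.le,
            ← Real.rpow_mul hm0.le, mul_comm]
  have hexp : Real.exp (-m) * Real.exp 1 ^ m = 1 := by
    rw [← Real.exp_nat_mul, mul_one, ← Real.exp_add, neg_add_cancel, Real.exp_zero]
  have hfpos : (0 : ℝ) < (((m.factorial : ℕ) : ℝ)) ^ s := by positivity
  calc C * h ^ m * (((m.factorial : ℕ) : ℝ)) ^ s
      < 2 ^ m * h ^ m * (((m.factorial : ℕ) : ℝ)) ^ s := by gcongr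
    _ ≤ 2 ^ m * h ^ m * ((m : ℝ) ^ s) ^ m := by gcongr
    _ = Real.exp (-m) * (2 * Real.exp 1 * h) ^ m * ((m : ℝ) ^ s) ^ m := by
        rw [mul_pow, mul_pow]
        linear_combination (-(2 ^ m * h ^ m * ((m : ℝ) ^ s) ^ m)) * hexp
    _ ≤ Real.exp (-m) * ((m : ℝ) ^ (σ - s)) ^ m * ((m : ℝ) ^ s) ^ m := by gcongr
    _ = Real.exp (-m) * ((m : ℝ) ^ σ) ^ m := by
        rw [mul_assoc, ← mul_pow, ← Real.rpow_add hm0, sub_add_cancel]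

theorem not_isGevrey_packet_series {s σ : ℝ} (hs : 0 ≤ s) (hsσ : s < σ) (hΩ : IsOpen Ω)
    (hx₀ : x₀ ∈ Ω) {i : Fin n} (hξ : ξ i = 1) :
    ¬ IsGevrey s Ω fun y => ∑' j, packetTerm x₀ ξ σ j y := by
  intro hG
  obtain ⟨C, _, h, hh, hb⟩ := hG.gevreyBoundAt hΩ isCompact_singleton
    (Set.singleton_subset_iff.2 hx₀)
  obtain ⟨m, hm⟩ := exists_lt_exp_neg_mul_pow (C := C) hs hsσ hh
  have h1 := hb x₀ rfl (List.replicate m i)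
  rw [List.length_replicate] at h1
  exact absurd (hm.trans_le ((le_norm_wordD_packet_series (hs.trans_lt hsσ) hξ m).trans h1))
    (lt_irrefl _)

end LowerBound

/-! ### Uniform Gevrey bounds on compact sets -/

/-- The derivatives of `f` satisfy Gevrey bounds of order `r`, uniformly on `K`. -/
def UniformGevreyOn {n : ℕ} (r : ℝ) (K : Set (Euc n)) (f : Euc n → ℂ) : Prop :=
  ∃ A, 0 ≤ A ∧ ∃ h, 1 ≤ h ∧ ∀ x ∈ K, GevreyBoundAt r A h f x

section UniformGevreyOn

variable {n : ℕ} {Ω K : Set (Euc n)} {f g : Euc n → ℂ} {x₀ ξ : Euc n} {r : ℝ}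

theorem UniformGevreyOn.exists_common {ι : Type*} (s : Finset ι) {F : ι → Euc n → ℂ}
    (hF : ∀ i ∈ s, UniformGevreyOn r K (F i)) :
    ∃ A, 0 ≤ A ∧ ∃ h, 1 ≤ h ∧ ∀ i ∈ s, ∀ x ∈ K, GevreyBoundAt r A h (F i) x := by
  classical
  induction s using Finset.induction_on with
  | empty => exact ⟨0, le_rfl, 1, le_rfl, by simp⟩
  | insert a s _ ih =>
    obtain ⟨A, hA, h, hh, hb⟩ := ih fun i hi => hF i (Finset.mem_insert_of_mem hi)
    obtain ⟨B, hB, k, hk, hb'⟩ := hF a (Finset.mem_insert_self a s)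
    refine ⟨max A B, hA.trans (le_max_left _ _), max h k, hh.trans (le_max_left _ _), ?_⟩
    intro i hi x hx
    rcases Finset.mem_insert.1 hi with rfl | hi
    · exact (hb' x hx).mono (le_max_right _ _) (by linarith) (le_max_right _ _)
    · exact (hb i hi x hx).mono (le_max_left _ _) (by linarith) (le_max_left _ _)

theorem UniformGevreyOn.mul (hΩ : IsOpen Ω) (hKΩ : K ⊆ Ω) (hr : 1 ≤ r)
    (hf : ContDiffOn ℝ ∞ f Ω) (hg : ContDiffOn ℝ ∞ g Ω) (hfK : UniformGevreyOn r K f)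
    (hgK : UniformGevreyOn r K g) : UniformGevreyOn r K fun y => f y * g y := by
  obtain ⟨A, hA, h, hh, hb⟩ := hfK
  obtain ⟨B, hB, k, hk, hb'⟩ := hgK
  have hm : 1 ≤ max h k := hh.trans (le_max_left _ _)
  refine ⟨A * B, by positivity, 2 * max h k, by linarith, fun x hx => ?_⟩
  exact ((hb x hx).mono le_rfl (by linarith) (le_max_left _ _)).mul hΩ hf hg (hKΩ hx) hr
    (by linarith) ((hb' x hx).mono le_rfl (by linarith) (le_max_right _ _))

theorem UniformGevreyOn.sum (hΩ : IsOpen Ω) (hKΩ : K ⊆ Ω) {ι : Type*} {s : Finset ι}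
    {F : ι → Euc n → ℂ} (hs : ∀ i ∈ s, ContDiffOn ℝ ∞ (F i) Ω)
    (hF : ∀ i ∈ s, UniformGevreyOn r K (F i)) :
    UniformGevreyOn r K fun y => ∑ i ∈ s, F i y := by
  obtain ⟨A, hA, h, hh, hb⟩ := UniformGevreyOn.exists_common s hF
  exact ⟨∑ _i ∈ s, A, Finset.sum_nonneg fun _ _ => hA, h, hh, fun x hx =>
    GevreyBoundAt.sum hΩ hs (hKΩ hx) fun i hi => hb i hi x hx⟩

theorem IsGevrey.uniformGevreyOn (hΩ : IsOpen Ω) (hf : IsGevrey r Ω f) (hK : IsCompact K)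
    (hKΩ : K ⊆ Ω) : UniformGevreyOn r K f := by
  obtain ⟨A, hA, h, hh, hb⟩ := hf.gevreyBoundAt hΩ hK hKΩ
  exact ⟨A, hA.le, max h 1, le_max_right _ _, fun x hx =>
    (hb x hx).mono le_rfl hh.le (le_max_left _ _)⟩

theorem uniformGevreyOn_complexCovector (hr : 0 ≤ r) (hK : IsCompact K) (i : Fin n) :
    UniformGevreyOn r K (complexCovector x₀ ξ i) := by
  obtain ⟨M, hM⟩ := hK.exists_bound_of_continuousOn
    (contDiff_complexCovector (x₀ := x₀) (ξ := ξ) i).continuous.continuousOn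
  refine ⟨max 1 M, zero_le_one.trans (le_max_left _ _), 1, le_rfl, fun x hx => ?_⟩
  exact gevreyBoundAt_complexCovector hr (le_max_left _ _) le_rfl i
    ((hM x hx).trans (le_max_right _ _))

theorem uniformGevreyOn_covectorWord (hr : 1 ≤ r) (hK : IsCompact K) (w : List (Fin n)) :
    UniformGevreyOn r K (covectorWord x₀ ξ w) := by
  induction w with
  | nil =>
    refine ⟨1, zero_le_one, 1, le_rfl, fun x _ => ?_⟩
    have := GevreyBoundAt.const (x := x) (r := r) zero_le_one (1 : ℂ)
    rwa [norm_one] at this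
  | cons j w ih =>
    have : covectorWord x₀ ξ (j :: w)
        = fun x => complexCovector x₀ ξ j x * covectorWord x₀ ξ w x := by
      funext x
      simp [covectorWord]
    rw [this]
    exact UniformGevreyOn.mul isOpen_univ (Set.subset_univ K) hr
      (contDiff_complexCovector j).contDiffOn (contDiff_covectorWord w).contDiffOn
      (uniformGevreyOn_complexCovector (by linarith) hK j) ih

/-- A function which is smooth near a compact set and vanishes at `x₀` vanishes there to first
order, uniformly on the compact set. -/
theorem exists_norm_le_mul_min (hΩ : IsOpen Ω) (hf : ContDiffOn ℝ ∞ f Ω) (hx₀ : x₀ ∈ Ω)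
    (hf0 : f x₀ = 0) (hK : IsCompact K) (hKΩ : K ⊆ Ω) :
    ∃ M, 0 ≤ M ∧ ∀ x ∈ K, ‖f x‖ ≤ M * min 1 ‖x - x₀‖ := by
  obtain ⟨M, hM⟩ := hK.exists_bound_of_continuousOn (hf.continuousOn.mono hKΩ)
  have hO := (hf.differentiableAt_of_isOpen hΩ hx₀).hasFDerivAt.isBigO_sub
  obtain ⟨c, hc⟩ := hO.bound
  obtain ⟨δ, hδ, hball⟩ := Metric.eventually_nhds_iff.1 hc
  have hδ1 : 0 < min 1 δ := lt_min one_pos hδ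
  -- The slope `c` serves close to `x₀`, the maximum `M` serves where the minimum is `1`, and the
  -- quotient serves at distance at least `δ`.
  refine ⟨|c| + |M| + |M| / min 1 δ, by positivity, fun x hx => ?_⟩
  have h1 : ‖f x‖ ≤ |M| := (hM x hx).trans (le_abs_self M)
  have hmin0 : 0 ≤ min 1 ‖x - x₀‖ := le_min zero_le_one (norm_nonneg _)
  have hq : 0 ≤ |M| / min 1 δ := by positivity
  rcases lt_or_ge ‖x - x₀‖ δ with hxδ | hxδ
  · have h2 := hball (y := x) (by rwa [dist_eq_norm])
    rw [hf0, sub_zero] at h2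
    have h3 : ‖f x‖ ≤ |c| * ‖x - x₀‖ :=
      h2.trans (mul_le_mul_of_nonneg_right (le_abs_self c) (norm_nonneg _))
    rcases min_cases 1 ‖x - x₀‖ with ⟨h, _⟩ | ⟨h, _⟩ <;> rw [h]
    · linarith [abs_nonneg c]
    · refine h3.trans (mul_le_mul_of_nonneg_right ?_ (norm_nonneg _))
      linarith [abs_nonneg M]
  · have h2 : min 1 δ ≤ min 1 ‖x - x₀‖ := min_le_min le_rfl hxδ
    calc ‖f x‖ ≤ |M| / min 1 δ * min 1 δ := by rwa [div_mul_cancel₀ _ hδ1.ne']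
      _ ≤ |M| / min 1 δ * min 1 ‖x - x₀‖ := by gcongr
      _ ≤ _ := by
        gcongr
        linarith [abs_nonneg c, abs_nonneg M]

end UniformGevreyOn

/-! ### The iterates of a non-elliptic operator on the series of wave packets -/

namespace LinDiffOp

variable {n : ℕ} {P : LinDiffOp n} {Ω K : Set (Euc n)} {f : Euc n → ℂ} {x x₀ ξ : Euc n}
  {r s σ : ℝ}

theorem HasGevreyCoeffs.hasSmoothCoeffs (hP : P.HasGevreyCoeffs r Ω) : P.HasSmoothCoeffs Ω :=
  fun α hα => (hP α hα).1

theorem principalSymbol_smul (c : ℝ) :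
    P.principalSymbol x (c • ξ) = (c : ℂ) ^ P.order * P.principalSymbol x ξ := by
  unfold principalSymbol
  rw [Finset.mul_sum]
  refine Finset.sum_congr rfl fun α hα => ?_
  rw [← sum_le_of_mem_order hα, ← Finset.prod_pow_eq_pow_sum]
  simp only [PiLp.smul_apply, smul_eq_mul, Complex.ofReal_mul, mul_pow, Finset.prod_mul_distrib]
  ring

/-- Homogeneity of the symbol allows the covector to be rescaled. A component equal to `1` is what
the lower bound for the derivatives of the packets needs. -/
theorem exists_principalSymbol_eq_zero (h : ¬ P.IsElliptic Ω) :
    ∃ x₀ ∈ Ω, ∃ (ξ : Euc n) (i : Fin n), ξ i = 1 ∧ P.principalSymbol x₀ ξ = 0 := by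
  unfold IsElliptic at h
  push Not at h
  obtain ⟨x₀, hx₀, ξ, hξ, h0⟩ := h
  obtain ⟨i, hi⟩ : ∃ i, ξ i ≠ 0 := by
    by_contra hcon
    push Not at hcon
    exact hξ (by ext i; simpa using hcon i)
  refine ⟨x₀, hx₀, (ξ i)⁻¹ • ξ, i, ?_, ?_⟩
  · rw [PiLp.smul_apply, smul_eq_mul, inv_mul_cancel₀ hi]
  · rw [principalSymbol_smul, h0, mul_zero]

theorem iterate_apply_const_mul (hΩ : IsOpen Ω) (hP : P.HasSmoothCoeffs Ω)
    (hf : ContDiffOn ℝ ∞ f Ω) (c : ℂ) (k : ℕ) :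
    Set.EqOn (P.apply^[k] fun y => c * f y) (fun y => c * P.apply^[k] f y) Ω := by
  induction k with
  | zero => exact fun _ _ => rfl
  | succ k ih =>
    intro x hx
    rw [Function.iterate_succ_apply', Function.iterate_succ_apply', apply_congr hΩ ih hx]
    simp only [apply, multiD_eq_wordD, Finset.mul_sum]
    refine Finset.sum_congr rfl fun l _ => Finset.sum_congr rfl fun α _ => ?_
    rw [wordD_const_mul hΩ (iterate_apply_contDiffOn hΩ hP hf k) c _ hx]
    ring

theorem uniformGevreyOn_covectorSymbol (hΩ : IsOpen Ω) (hr : 1 ≤ r)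
    (hP : P.HasGevreyCoeffs r Ω) (hK : IsCompact K) (hKΩ : K ⊆ Ω) :
    UniformGevreyOn r K (P.covectorSymbol x₀ ξ) := by
  unfold covectorSymbol
  have hsm := hP.hasSmoothCoeffs
  refine UniformGevreyOn.sum hΩ hKΩ (fun α hα => ?_) fun α hα => ?_
  · exact (hsm α (sum_le_of_mem_order hα).le).mul (contDiff_covectorWord _).contDiffOn
  · exact ((hP α (sum_le_of_mem_order hα).le).uniformGevreyOn hΩ hK hKΩ).mul hΩ hKΩ hr
      (hsm α (sum_le_of_mem_order hα).le) (contDiff_covectorWord _).contDiffOn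
      (uniformGevreyOn_covectorWord hr hK _)

theorem exists_common_gevreyBound (hΩ : IsOpen Ω) (hr : 1 ≤ r)
    (hP : P.HasGevreyCoeffs r Ω) (hK : IsCompact K) (hKΩ : K ⊆ Ω) (hx₀ : x₀ ∈ Ω)
    (hξ : P.principalSymbol x₀ ξ = 0) :
    ∃ A, 0 ≤ A ∧ ∃ h, 1 ≤ h ∧ ∀ x ∈ K,
      (∀ i, GevreyBoundAt r A h (complexCovector x₀ ξ i) x) ∧
      (∀ α : Fin n → ℕ, ∑ i, α i ≤ P.order → GevreyBoundAt r A h (P.coeff α) x) ∧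
      GevreyBoundAt r A h (P.covectorSymbol x₀ ξ) x ∧
      ‖P.covectorSymbol x₀ ξ x‖ ≤ A * min 1 ‖x - x₀‖ := by
  classical
  obtain ⟨A₁, hA₁, h₁, hh₁, hb₁⟩ := UniformGevreyOn.exists_common (r := r) (K := K) Finset.univ
    fun i _ => uniformGevreyOn_complexCovector (x₀ := x₀) (ξ := ξ) (by linarith) hK i
  obtain ⟨A₂, hA₂, h₂, hh₂, hb₂⟩ := UniformGevreyOn.exists_common (r := r) (K := K)
    ((Finset.range (P.order + 1)).biUnion
      fun l => Finset.piAntidiag (Finset.univ : Finset (Fin n)) l) (F := P.coeff) fun α hα => by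
        obtain ⟨l, hl, hα⟩ := Finset.mem_biUnion.1 hα
        exact (hP α (sum_le_of_mem hl hα).2).uniformGevreyOn hΩ hK hKΩ
  obtain ⟨A₃, hA₃, h₃, hh₃, hb₃⟩ := uniformGevreyOn_covectorSymbol (x₀ := x₀) (ξ := ξ)
    hΩ hr hP hK hKΩ
  obtain ⟨M, hM, hb₄⟩ := exists_norm_le_mul_min hΩ
    (covectorSymbol_contDiffOn (x₀ := x₀) (ξ := ξ) hP.hasSmoothCoeffs) hx₀
    (by rw [covectorSymbol_self, hξ]) hK hKΩ
  refine ⟨A₁ + A₂ + A₃ + M, by positivity, h₁ + h₂ + h₃, by linarith, fun x hx => ⟨?_, ?_, ?_, ?_⟩⟩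
  · exact fun i => (hb₁ i (Finset.mem_univ i) x hx).mono (by linarith) (by linarith) (by linarith)
  · intro α hα
    refine (hb₂ α ?_ x hx).mono (by linarith) (by linarith) (by linarith)
    exact Finset.mem_biUnion.2 ⟨∑ i, α i, Finset.mem_range_succ_iff.2 hα,
      Finset.mem_piAntidiag.2 ⟨rfl, by simp⟩⟩
  · exact (hb₃ x hx).mono (by linarith) (by linarith) (by linarith)
  · refine (hb₄ x hx).trans (mul_le_mul_of_nonneg_right (by linarith) ?_)
    exact le_min zero_le_one (norm_nonneg _)

theorem conjConst_nonneg {h A B : ℝ} (hh : 0 ≤ h) (hA : 0 ≤ A) (hB : 0 ≤ B) :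
    0 ≤ P.conjConst h A B := by
  unfold conjConst
  positivity

/-- The iterates of `P` on the terms of the series decay, with Gevrey bounds. -/
theorem exists_norm_iterate_apply_packetTerm_le (hΩ : IsOpen Ω) (hr : 1 ≤ r) (hrs : r < s)
    (hsσ : s < σ) (hσ : P.order ≠ 0 → σ * (P.order - 1 / 2) + r / 2 ≤ s * P.order)
    (hP : P.HasGevreyCoeffs r Ω) (hK : IsCompact K) (hKΩ : K ⊆ Ω) (hx₀ : x₀ ∈ Ω)
    (hξ : P.principalSymbol x₀ ξ = 0) :
    ∃ H, 0 < H ∧ ∀ (k j : ℕ), ∀ x ∈ K, ‖P.apply^[k] (packetTerm x₀ ξ σ j) x‖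
      ≤ Real.exp (-(j / 2)) * (2 * H ^ k * (((P.order * k).factorial : ℕ) : ℝ) ^ s) := by
  obtain ⟨A, hA, h, hh, hb⟩ := exists_common_gevreyBound (x₀ := x₀) (ξ := ξ) hΩ hr hP hK hKΩ hx₀ hξ
  have hsm := hP.hasSmoothCoeffs
  set C := P.conjConst h A A with hC
  have hC0 : 0 ≤ C := conjConst_nonneg (by linarith) hA hA
  set D : ℝ := (2 * σ) ^ (σ * P.order) * Real.exp (s * P.order) with hD
  have hD0 : 0 < D := by
    have : 0 < 2 * σ := by linarith
    positivity
  -- `C` comes from conjugation and `D` from the summation estimate; the added `1` only ensures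
  -- positivity.
  refine ⟨(C + 1) * D, by positivity, fun k j x hx => ?_⟩
  obtain ⟨hη, hcoeff, hsym, hsmall⟩ := hb x hx
  have hxΩ := hKΩ hx
  set ρ := min 1 ‖x - x₀‖ with hρ
  have hρ0 : 0 ≤ ρ := le_min zero_le_one (norm_nonneg _)
  have hρ1 : ρ ≤ 1 := min_le_left _ _
  have hlam : 0 ≤ (j : ℝ) ^ σ := by positivity
  have hY1 : (1 : ℝ) ≤ ((max 1 (P.order * k) : ℕ) : ℝ) ^ r :=
    Real.one_le_rpow (by exact_mod_cast le_max_left _ _) (by linarith)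
  obtain ⟨Y, hY⟩ : ∃ Y, Y = ((max 1 (P.order * k) : ℕ) : ℝ) ^ r := ⟨_, rfl⟩
  obtain ⟨Λ, hΛ⟩ : ∃ Λ, Λ = max ((j : ℝ) ^ σ) Y := ⟨_, rfl⟩
  rw [← hY] at hY1
  have hYΛ : Y ≤ Λ := hΛ ▸ le_max_right _ _
  have hΛ0 : 0 < Λ := by linarith
  have hterm := packet_term_le hr hrs hsσ hσ k j hρ0 hρ1 rfl hY hΛ
  -- The gain `t` must dominate the distance `ρ`, which bounds the symbol, and satisfy `Y ≤ t ^ 2 *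
  -- Λ`; the maximum is the least such value. `N` is the total number of derivatives in `P^k`.
  let W : DerivWeight :=
    { r := r, h := h, Y := Y, Λ := Λ, t := max ρ √(Y / Λ), N := P.order * k
      one_le_r := hr
      one_le_h := hh
      one_le_Y := hY1
      pow_le_Y := by
        rw [hY]
        gcongr
        exact le_max_right _ _
      t_nonneg := hρ0.trans (le_max_left _ _)
      t_le_one := by
        refine max_le hρ1 (Real.sqrt_le_one.2 ?_)
        rwa [div_le_one hΛ0]
      Y_le := by
        have h1 : Y / Λ ≤ max ρ √(Y / Λ) ^ 2 := by
          calc Y / Λ = √(Y / Λ) ^ 2 := (Real.sq_sqrt (by positivity)).symm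
            _ ≤ _ := by
              gcongr
              exact le_max_right _ _
        rwa [div_le_iff₀ hΛ0] at h1 }
  have hl : |(j : ℝ) ^ σ| ≤ W.Λ := by
    rw [abs_of_nonneg hlam]
    exact (le_max_left _ _).trans_eq hΛ.symm
  have hconj : ‖(P.conj x₀ ξ ((j : ℝ) ^ σ))^[k] (fun _ => 1) x‖
      ≤ (C * Λ ^ P.order) ^ k * max ρ √(Y / Λ) ^ k :=
    norm_iterate_conj_le (W := W) hΩ hsm hxΩ hl hη hcoeff hsym
      (hsmall.trans (mul_le_mul_of_nonneg_left (le_max_left _ _) hA)) k le_rfl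
  have hwave : ‖wavePacket x₀ ξ ((j : ℝ) ^ σ) x‖
      ≤ Real.exp (-((j : ℝ) ^ σ * ρ ^ 2 / 2)) := by
    rw [norm_wavePacket]
    have : ρ ^ 2 ≤ ‖x - x₀‖ ^ 2 := pow_le_pow_left₀ hρ0 (min_le_right _ _) 2
    gcongr
  unfold packetTerm
  rw [iterate_apply_const_mul hΩ hsm contDiff_wavePacket.contDiffOn _ k hxΩ]
  simp only
  rw [iterate_apply_wavePacket hΩ hsm k hxΩ, norm_mul, norm_mul, Complex.norm_real,
    Real.norm_of_nonneg (Real.exp_pos _).le]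
  calc Real.exp (-j) * (‖wavePacket x₀ ξ ((j : ℝ) ^ σ) x‖ *
        ‖(P.conj x₀ ξ ((j : ℝ) ^ σ))^[k] (fun _ => 1) x‖)
      ≤ Real.exp (-j) * (Real.exp (-((j : ℝ) ^ σ * ρ ^ 2 / 2)) *
          ((C * Λ ^ P.order) ^ k * max ρ √(Y / Λ) ^ k)) := by gcongr
    _ = C ^ k * (Real.exp (-j) * (Real.exp (-((j : ℝ) ^ σ * ρ ^ 2 / 2)) *
          ((Λ ^ P.order) ^ k * max ρ √(Y / Λ) ^ k))) := by
        rw [mul_pow]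
        ring
    _ ≤ C ^ k * (Real.exp (-(j / 2)) *
          (2 * D ^ k * (((P.order * k).factorial : ℕ) : ℝ) ^ s)) := by gcongr
    _ ≤ (C + 1) ^ k * (Real.exp (-(j / 2)) *
          (2 * D ^ k * (((P.order * k).factorial : ℕ) : ℝ) ^ s)) := by
        gcongr
        linarith
    _ = _ := by
        rw [mul_pow (C + 1) D]
        ring

theorem isGevreyVector_packet_series (hΩ : IsOpen Ω) (hr : 1 ≤ r) (hrs : r < s)
    (hsσ : s < σ) (hσ : P.order ≠ 0 → σ * (P.order - 1 / 2) + r / 2 ≤ s * P.order)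
    (hP : P.HasGevreyCoeffs r Ω) (hx₀ : x₀ ∈ Ω) (hξ : P.principalSymbol x₀ ξ = 0) :
    P.IsGevreyVector s Ω fun y => ∑' j, packetTerm x₀ ξ σ j y := by
  intro K hK hKΩ
  have hsm := hP.hasSmoothCoeffs
  have hu := hasSmoothSum_packetTerm (Ω := Ω) (x₀ := x₀) (ξ := ξ) (σ := σ) (by linarith)
  set u : Euc n → ℂ := fun y => ∑' j, packetTerm x₀ ξ σ j y
  obtain ⟨H, hH, hb⟩ := exists_norm_iterate_apply_packetTerm_le (x₀ := x₀) (ξ := ξ) hΩ hr hrs hsσ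
    hσ hP hK hKΩ hx₀ hξ
  have hsum : Summable fun j : ℕ => Real.exp (-((j : ℝ) / 2)) := by
    refine (Real.summable_exp_nat_mul_iff.2 (by norm_num : (-(1 / 2) : ℝ) < 0)).congr fun j => ?_
    congr 1
    ring
  set S := ∑' j : ℕ, Real.exp (-((j : ℝ) / 2))
  have hS : 0 ≤ S := tsum_nonneg fun j => (Real.exp_pos _).le
  have hbound : ∀ k : ℕ, ∀ x ∈ K, ‖P.apply^[k] u x‖
      ≤ S * (2 * H ^ k * (((P.order * k).factorial : ℕ) : ℝ) ^ s) := by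
    intro k x hx
    have h1 := (hu.iterate_apply hΩ hsm k).hasSum [] x (hKΩ hx)
    simp only [wordD_nil] at h1
    rw [← h1.tsum_eq]
    exact tsum_of_norm_bounded (hsum.hasSum.mul_right _) fun j => hb k j x hx
  have hfin : MeasureTheory.volume K ≠ ⊤ := hK.measure_lt_top.ne
  have : MeasureTheory.IsFiniteMeasure (MeasureTheory.volume.restrict K) :=
    ⟨by simpa using hK.measure_lt_top⟩
  have hae : ∀ k : ℕ, ∀ᵐ x ∂(MeasureTheory.volume.restrict K), ‖P.apply^[k] u x‖
      ≤ S * (2 * H ^ k * (((P.order * k).factorial : ℕ) : ℝ) ^ s) := fun k =>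
    (MeasureTheory.ae_restrict_iff' hK.measurableSet).2 (Filter.Eventually.of_forall (hbound k))
  refine ⟨fun k => ?_, ?_⟩
  · refine MeasureTheory.MemLp.of_bound ?_ _ (hae k)
    exact ((iterate_apply_contDiffOn hΩ hsm hu.contDiffOn k).continuousOn.mono
      hKΩ).aestronglyMeasurable hK.measurableSet
  · set V := MeasureTheory.volume K ^ ((2 : ENNReal).toReal)⁻¹ with hV
    have hVtop : V ≠ ⊤ := ENNReal.rpow_ne_top_of_nonneg (by simp) hfin
    -- `V` is the square root of the volume of `K`, which passes from the sup bound to the `L²`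
    -- norm.
    refine ⟨2 * (S + 1) * (V.toReal + 1), by positivity, H, hH, fun k => ?_⟩
    refine (MeasureTheory.eLpNorm_le_of_ae_bound (hae k)).trans ?_
    rw [MeasureTheory.Measure.restrict_apply_univ, ← hV, ← ENNReal.ofReal_toReal hVtop,
      ← ENNReal.ofReal_mul ENNReal.toReal_nonneg]
    apply ENNReal.ofReal_le_ofReal
    rw [ENNReal.toReal_ofReal ENNReal.toReal_nonneg]
    calc V.toReal * (S * (2 * H ^ k * (((P.order * k).factorial : ℕ) : ℝ) ^ s))
        ≤ (V.toReal + 1) * ((S + 1) * (2 * H ^ k * (((P.order * k).factorial : ℕ) : ℝ) ^ s)) := by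
          gcongr <;> linarith
      _ = _ := by ring

end LinDiffOp

/-! ### Choice of the frequency exponent and conclusion. -/

theorem exists_packet_exponent {r s : ℝ} (hrs : r < s) (d : ℕ) :
    ∃ σ, s < σ ∧ (d ≠ 0 → σ * (d - 1 / 2) + r / 2 ≤ s * d) := by
  rcases eq_or_ne d 0 with hd | hd
  · exact ⟨s + 1, by linarith, fun h => absurd hd h⟩
  · have hd1 : (1 : ℝ) ≤ d := by exact_mod_cast Nat.one_le_iff_ne_zero.2 hd
    have hpos : (0 : ℝ) < d - 1 / 2 := by linarith
    -- The value giving equality in the constraint; it exceeds `s` exactly because `r / 2 < s / 2`.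
    refine ⟨(s * d - r / 2) / (d - 1 / 2), ?_, fun _ => ?_⟩
    · rw [lt_div_iff₀ hpos]
      linarith
    · rw [div_mul_cancel₀ _ hpos.ne']
      linarith

theorem corollary4p6 {n : ℕ} (Ω : Set (EuclideanSpace ℝ (Fin n))) (hΩ : IsOpen Ω)
    (r s : ℝ) (hr : 1 ≤ r) (hrs : r < s) (P : LinDiffOp n)
    (hP : P.HasGevreyCoeffs r Ω) (hell : ¬ P.IsElliptic Ω) :
    ∃ u : EuclideanSpace ℝ (Fin n) → ℂ,
      ContDiffOn ℝ ∞ u Ω ∧ P.IsGevreyVector s Ω u ∧ ¬ IsGevrey s Ω u := by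
  obtain ⟨x₀, hx₀, ξ, i, hξi, hξ⟩ := LinDiffOp.exists_principalSymbol_eq_zero hell
  obtain ⟨σ, hsσ, hσ⟩ := exists_packet_exponent hrs P.order
  exact ⟨fun y => ∑' j, packetTerm x₀ ξ σ j y,
    (hasSmoothSum_packetTerm (by linarith)).contDiffOn,
    LinDiffOp.isGevreyVector_packet_series hΩ hr hrs hsσ hσ hP hx₀ hξ,
    not_isGevrey_packet_series (by linarith) hsσ hΩ hx₀ hξi⟩
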